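/- For a probability measure $\mu$ on $\mathbb R^n$ and a convex set $Q\subset\mathbb R^n$ let $$\mu^+(\partial Q)=\liminf_{\varepsilon\to 0^+}\frac{\mu\big((Q+\varepsilon B_2^n)\setminus Q\big)}{\varepsilon},\qquad \Gamma(\mu)=\sup_{Q}\mu^+(\partial Q),$$ where $B_2^n$ is the closed Euclidean unit ball and the supremum runs over all convex sets $Q\subset\mathbb R^n$. For a random vector $X$ in $\mathbb R^n$ with distribution $\mu$ write $\Gamma(X)=\Gamma(\mu)$. A density $f$ is called unimodal if all its level sets $\{x: f(x)\ge t\}$, $t>0$, are convex. Theorem. There is an absolute constant $C>0$ such that for every $n$ and every random vector $X$ in $\mathbb R^n$ having an absolutely continuous distribution with a unimodal density $f$, there exists a volume-preserving linear map $T:\mathbb R^n\to\mathbb R^n$ with $$\Gamma(TX)\le C\,n\,\|f\|_\infty^{1/n}.$$ This bound is attained, up to the value of the constant $C$, by the uniform distribution on the cube: if $X$ is uniformly distributed on $[-1,1]^n$, with density $f=2^{-n}\mathbf 1_{[-1,1]^n}$, then $\Gamma(X)=2n\|f\|_\infty^{1/n}$, and $\Gamma(TX)\ge 2n\|f\|_\infty^{1/n}$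 for every volume-preserving linear map $T$. -/

import Mathlib

open MeasureTheory ProbabilityTheory Filter Set
open scoped ENNReal Pointwise Topology

noncomputable section

/-- The surface area of `Q` with respect to `μ`:
`μ⁺(∂Q) = liminf_{ε → 0+} μ((Q + ε B) \ Q) / ε`, where `B` is the closed Euclidean unit ball. -/
def perimeter {n : ℕ} (μ : Measure (EuclideanSpace ℝ (Fin n)))
    (Q : Set (EuclideanSpace ℝ (Fin n))) : ℝ≥0∞ :=
  liminf (fun ε : ℝ => μ ((Q + ε • Metric.closedBall (0 : EuclideanSpace ℝ (Fin n)) 1) \ Q) /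
    ENNReal.ofReal ε) (𝓝[>] (0 : ℝ))

/-- The maximal perimeter `Γ(μ)`: the supremum of `μ⁺(∂Q)` over all convex sets `Q`. -/
def maxPerimeter {n : ℕ} (μ : Measure (EuclideanSpace ℝ (Fin n))) : ℝ≥0∞ :=
  ⨆ (Q : Set (EuclideanSpace ℝ (Fin n))) (_ : Convex ℝ Q), perimeter μ Q

/-- `Γ(X)`: the maximal perimeter with respect to the distribution of the random vector `X`. -/
def Gam {n : ℕ} {Ω : Type*} [MeasurableSpace Ω] (P : Measure Ω)
    (X : Ω → EuclideanSpace ℝ (Fin n)) : ℝ≥0∞ :=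
  maxPerimeter (P.map X)

/-- The random vector `X` has an absolutely continuous distribution with density `f`. -/
structure HasDensity {n : ℕ} {Ω : Type*} [MeasurableSpace Ω] (P : Measure Ω)
    (X : Ω → EuclideanSpace ℝ (Fin n)) (f : EuclideanSpace ℝ (Fin n) → ℝ) : Prop where
  nonneg : ∀ x, 0 ≤ f x
  aemeasurable : AEMeasurable f volume
  hasLaw : HasLaw X (volume.withDensity fun x => ENNReal.ofReal (f x)) P

/-- `f` is unimodal: all its level sets `{f ≥ t}`, `t > 0`, are convex. -/
def IsUnimodal {n : ℕ} (f : EuclideanSpace ℝ (Fin n) → ℝ) : Prop :=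
  ∀ t : ℝ, 0 < t → Convex ℝ {x | t ≤ f x}

/-- The cube `[-1, 1]ⁿ`. -/
def cube (n : ℕ) : Set (EuclideanSpace ℝ (Fin n)) := {x | ∀ i, |x i| ≤ 1}

/-- The density of the uniform distribution on `K`. -/
def uniformDensity {n : ℕ} (K : Set (EuclideanSpace ℝ (Fin n))) :
    EuclideanSpace ℝ (Fin n) → ℝ :=
  K.indicator fun _ => (volume.real K)⁻¹

end

/-! ### Mass gained by sweeping a convex set along segments. -/

section Telescoping

variable {E : Type*} [NormedAddCommGroup E] [NormedSpace ℝ E]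

/-! Upper bound. Put M = ‖f‖_∞, c_j = M / 2^(j+1) and K_j = {f ≥ c_j}, an increasing sequence of
convex sets. The sum of c_j·1_{K_j} is comparable to f; replace each indicator by a Lipschitz
majorant q_j built from the gauge of K_j, and let V(j, x) = c_j ∇q_j(x), a vector field on ℕ × ℝⁿ.

The part that a convex set gains when swept along [0, w] has pairwise disjoint translates by
multiples of w. Telescoping along them bounds the gained mass by the L¹ norm of the increments of
the density (`setLIntegral_sweep_le`), whatever the convex set. By Khintchine's inequality the unit
ball lies in a zonotope spanned by the sign vectors, whose support function is comparable to the
norm, so Γ(TX) ≤ 4 ∫ ‖(T⁻¹)* V‖ (`maxPerimeter_map_le`). It remains to find B with |det B| = 1 and ∫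
‖BV‖ small.

Take B minimizing this integral, up to scaling. First order optimality makes the field isotropic, so
the normalized squared determinant of n samples of it integrates to exactly n!/nⁿ. With Hadamard's
inequality, (∫ ‖BV‖)ⁿ ≤ (nⁿ/n!) ∫ |det(V₁, …, V_n)| (`exists_unimodular_position`).

The last integral is bounded in `lintegral_vecDet_le`. Sort the n samples by their smallest label j,
and let the ellipsoid A_j(ball), up to translation, fill K_j up to a factor 36ⁿ in volume
(`exists_ellipsoid`). It also fits into every K_k with k ≥ j, so ∫ ‖A_j* ∇q_k‖ ≤ 3n vol K_k
(`exists_lipschitz_majorant`). Apply Hadamard to the vectors A_j* V_i: n - 1 factors cost at most 6n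
each because Σ c_k vol K_k ≤ 2, and the factor in layer j cancels det A_j and leaves a multiple of
c_j, with Σ c_j ≤ 2M. Stirling-type bounds then give a constant times n M^(1/n).

Cube. Here 2n‖f‖_∞^(1/n) = n. The upper bound uses the same sweeping along the 2n vectors ±e_i, each
costing ε/2. For the lower bound the test sets are T(sQ) with Q the cube and s < 1 close to 1: the
ε-neighbourhood pulled back by T contains slabs of height ε‖row_i‖ over the faces, row_i being the
rows of T⁻¹, and Σ‖row_i‖ ≥ n by Hadamard and the arithmetic-geometric mean inequality. -/

/-- The part added to a convex set by sweeping it along a segment `[0, w]` is disjoint from its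
translates by multiples of `w`. -/
theorem not_mem_sweep_of_mem_sweep {Q : Set E} (hQ : Convex ℝ Q) {w x : E}
    (hx : x ∈ (Q + segment ℝ 0 w) \ Q) {m : ℕ} (hm : 1 ≤ m) :
    x + (m : ℝ) • w ∉ (Q + segment ℝ 0 w) \ Q := by
  rintro ⟨hy, -⟩
  obtain ⟨⟨q₀, hq₀, s₀, hs₀, hx₀⟩, hxQ⟩ := hx
  obtain ⟨q₁, hq₁, s₁, hs₁, hx₁⟩ := hy
  rw [segment_eq_image] at hs₀ hs₁
  obtain ⟨a, ⟨ha0, ha1⟩, rfl⟩ := hs₀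
  obtain ⟨b, ⟨hb0, hb1⟩, rfl⟩ := hs₁
  simp only [smul_zero, zero_add] at hx₀ hx₁
  have hm' : (1 : ℝ) ≤ m := by exact_mod_cast hm
  apply hxQ
  -- `q₀ = x - a w` and `q₁ = x + (m - b) w` lie on opposite sides of `x` on one line, so convexity
  -- puts `x` in `Q`. If both coefficients vanish, `x` is `q₀` itself.
  rcases eq_or_lt_of_le (show 0 ≤ a + (m - b) by linarith) with h | h
  · have : a = 0 := by linarith
    rw [this] at hx₀
    simp at hx₀
    rwa [← hx₀]
  · have hc := hQ hq₀ hq₁ (a := (m - b) / (a + (m - b))) (b := a / (a + (m - b)))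
      (div_nonneg (by linarith) h.le) (div_nonneg ha0 h.le)
      (by rw [← add_div, add_comm, div_self h.ne'])
    convert hc using 1
    have e0 : q₀ = x - a • w := by rw [← hx₀]; simp
    have e1 : q₁ = x + ((m : ℝ) - b) • w := by
      rw [sub_smul, ← add_sub_assoc, ← hx₁]; simp
    rw [e0, e1]
    have h' : a + ((m : ℝ) - b) ≠ 0 := h.ne'
    have : x = ((m - b) / (a + (m - b)) + a / (a + (m - b))) • x := by
      rw [← add_div, add_comm, div_self h', one_smul]
    conv_lhs => rw [this]
    simp only [smul_add, smul_sub, add_smul, smul_smul]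
    rw [show (m - b) / (a + (m - b)) * a = a / (a + (m - b)) * (m - b) by ring]
    abel

theorem convex_sum_segment {ι : Type*} (s : Finset ι) (w : ι → E) :
    Convex ℝ (∑ i ∈ s, segment ℝ (0 : E) (w i)) := by
  classical
  induction s using Finset.induction_on with
  | empty => exact convex_singleton (𝕜 := ℝ) (0 : E)
  | insert i s hi ih =>
    rw [Finset.sum_insert hi]
    exact (convex_segment (𝕜 := ℝ) (0 : E) (w i)).add ih

variable [MeasurableSpace E] [BorelSpace E] [FiniteDimensional ℝ E]

/-- The mass of the part added to a convex set by sweeping it along a segment `[0, w]` is at most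
the integral of the positive part of the increments of the density along `-w`. -/
theorem setLIntegral_sweep_le (μ : Measure E) [μ.IsAddHaarMeasure] {Q : Set E}
    (hQ : Convex ℝ Q) (w : E) {φ : E → ℝ≥0∞} (hφ : AEMeasurable φ μ) (hfin : ∫⁻ x, φ x ∂μ ≠ ∞) :
    ∫⁻ x in (Q + segment ℝ 0 w) \ Q, φ x ∂μ ≤ ∫⁻ x, (φ x - φ (x + w)) ∂μ := by
  set W := (Q + segment ℝ 0 w) \ Q with hW
  have hWm : NullMeasurableSet W μ :=
    ((hQ.add (convex_segment _ _)).nullMeasurableSet μ).diff (hQ.nullMeasurableSet μ)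
  have qmp : ∀ v : E, Measure.QuasiMeasurePreserving (fun x => x + v) μ μ := fun v =>
    (measurePreserving_add_right μ v).quasiMeasurePreserving
  have hφt : ∀ v : E, AEMeasurable (fun x => φ (x + v)) μ := fun v =>
    hφ.comp_quasiMeasurePreserving (qmp v)
  -- The translates `W + k w`. They are disjoint, so the masses `b k` of `φ` on them are summable
  -- and tend to zero.
  let Wk : ℕ → Set E := fun k => (fun x => x + (-((k : ℝ) • w))) ⁻¹' W
  have hWk : ∀ k, NullMeasurableSet (Wk k) μ := fun k => hWm.preimage (qmp _)
  have hdisj : Pairwise (Function.onFun Disjoint Wk) := by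
    have key : ∀ i j : ℕ, i < j → Disjoint (Wk i) (Wk j) := by
      intro i j hij
      rw [Set.disjoint_left]
      intro x hxi hxj
      have := not_mem_sweep_of_mem_sweep hQ (x := x + -((j : ℝ) • w)) hxj
        (m := j - i) (by omega)
      apply this
      have e : x + -((j : ℝ) • w) + ((j - i : ℕ) : ℝ) • w = x + -((i : ℝ) • w) := by
        rw [Nat.cast_sub hij.le, sub_smul]
        abel
      rw [e]
      exact hxi
    intro i j hij
    rcases lt_or_gt_of_ne hij with h | h
    · exact key i j h
    · exact (key j i h).symm
  have trans : ∀ (k : ℕ) (g : E → ℝ≥0∞),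
      ∫⁻ x in W, g (x + (k : ℝ) • w) ∂μ = ∫⁻ x in Wk k, g x ∂μ := by
    intro k g
    have hmp := (measurePreserving_add_right μ ((k : ℝ) • w))
    have := hmp.setLIntegral_comp_preimage_emb
      (MeasurableEquiv.addRight ((k : ℝ) • w)).measurableEmbedding g (Wk k)
    rw [← this]
    congr 2
    ext x
    simp [Wk]
  set b : ℕ → ℝ≥0∞ := fun k => ∫⁻ x in W, φ (x + (k : ℝ) • w) ∂μ with hb
  have hsum : ∑' k, b k ≤ ∫⁻ x, φ x ∂μ := by
    simp_rw [hb, trans]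
    rw [← lintegral_iUnion₀ hWk (fun _ _ h => (hdisj h).aedisjoint)]
    exact setLIntegral_le_lintegral _ _
  have hb0 : Tendsto b atTop (𝓝 0) :=
    ENNReal.tendsto_atTop_zero_of_tsum_ne_top (ne_top_of_le_ne_top hfin hsum)
  set ψ : E → ℝ≥0∞ := fun x => φ x - φ (x + w) with hψ
  -- Truncated subtraction makes `ψ` the positive part of the drop of `φ`, so it pays for passing
  -- from one translate to the next. Summing over the disjoint `Wk` costs at most one full integral
  -- of `ψ`.
  have step : ∀ k, b k ≤ b (k + 1) + ∫⁻ x in Wk k, ψ x ∂μ := by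
    intro k
    rw [← trans k ψ, hb]
    simp only
    rw [← lintegral_add_left' (hφt _).restrict]
    refine lintegral_mono fun x => ?_
    simp only [hψ, Nat.cast_add, Nat.cast_one, add_smul, one_smul, ← add_assoc]
    exact le_add_tsub
  have tel : ∀ N, b 0 ≤ b N + ∑ k ∈ Finset.range N, ∫⁻ x in Wk k, ψ x ∂μ := by
    intro N
    induction N with
    | zero => simp
    | succ N ih =>
      refine ih.trans ?_
      rw [Finset.sum_range_succ, add_comm (∑ k ∈ Finset.range N, _), ← add_assoc]
      exact add_le_add_left (step N) _
  have tot : ∀ N, ∑ k ∈ Finset.range N, ∫⁻ x in Wk k, ψ x ∂μ ≤ ∫⁻ x, ψ x ∂μ := by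
    intro N
    refine (ENNReal.sum_le_tsum _).trans ?_
    rw [← lintegral_iUnion₀ hWk (fun _ _ h => (hdisj h).aedisjoint)]
    exact setLIntegral_le_lintegral _ _
  have h0 : b 0 = ∫⁻ x in W, φ x ∂μ := by simp [hb]
  rw [← h0]
  have : Tendsto (fun N => b N + ∫⁻ x, ψ x ∂μ) atTop (𝓝 (0 + ∫⁻ x, ψ x ∂μ)) :=
    hb0.add_const _
  rw [zero_add] at this
  exact ge_of_tendsto' this fun N => (tel N).trans (by gcongr; exact tot N)

/-- Sweeping a convex set along a zonotope costs at most the sum of the increments of the density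
along its generators. -/
theorem setLIntegral_zonotope_le (μ : Measure E) [μ.IsAddHaarMeasure] {ι : Type*} (s : Finset ι)
    (w : ι → E) {Q : Set E} (hQ : Convex ℝ Q) {φ : E → ℝ≥0∞} (hφ : AEMeasurable φ μ)
    (hfin : ∫⁻ x, φ x ∂μ ≠ ∞) :
    ∫⁻ x in (Q + ∑ i ∈ s, segment ℝ 0 (w i)) \ Q, φ x ∂μ ≤
      ∑ i ∈ s, ∫⁻ x, (φ x - φ (x + w i)) ∂μ := by
  classical
  induction s using Finset.induction_on with
  | empty => simp
  | insert i s hi ih =>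
    rw [Finset.sum_insert hi, Finset.sum_insert hi]
    set S := ∑ i ∈ s, segment ℝ (0 : E) (w i)
    -- The new generator sweeps `Q + S`, which is again convex, so the one-segment bound applies to
    -- it.
    have hsub : (Q + (segment ℝ 0 (w i) + S)) \ Q ⊆
        (((Q + S) + segment ℝ 0 (w i)) \ (Q + S)) ∪ ((Q + S) \ Q) := by
      rw [add_comm (segment ℝ 0 (w i)) S, ← add_assoc]
      intro x hx
      by_cases h : x ∈ Q + S
      · exact Or.inr ⟨h, hx.2⟩
      · exact Or.inl ⟨hx.1, h⟩
    calc _ ≤ ∫⁻ x in (((Q + S) + segment ℝ 0 (w i)) \ (Q + S)) ∪ ((Q + S) \ Q), φ x ∂μ :=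
          lintegral_mono_set hsub
      _ ≤ _ := lintegral_union_le _ _ _
      _ ≤ _ := add_le_add
        (setLIntegral_sweep_le μ (hQ.add (convex_sum_segment s w)) _ hφ hfin) ih

end Telescoping

/-! ### Moments of random signs and Khintchine's inequality. -/

section Khintchine

variable {ι : Type*} [DecidableEq ι]

/-- The sign pattern that is `1` on `s` and `-1` off `s`. -/
def signPattern (s : Finset ι) (i : ι) : ℝ := if i ∈ s then 1 else -1

/-- Conditioning on the sign of `a`; this drives the induction for both moments. -/
theorem sum_signPattern_insert (a : ι) (t : Finset ι) (ha : a ∉ t) (v : ι → ℝ) (g : ℝ → ℝ) :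
    ∑ s ∈ (insert a t).powerset, g (∑ i ∈ insert a t, signPattern s i * v i) =
      ∑ s ∈ t.powerset, (g ((∑ i ∈ t, signPattern s i * v i) - v a) +
        g ((∑ i ∈ t, signPattern s i * v i) + v a)) := by
  rw [Finset.sum_powerset_insert ha, Finset.sum_add_distrib]
  congr 1
  · refine Finset.sum_congr rfl fun s hs => ?_
    have : a ∉ s := fun h => ha (Finset.mem_powerset.1 hs h)
    rw [Finset.sum_insert ha]
    simp only [signPattern, this, if_false]
    congr 1; ring
  · refine Finset.sum_congr rfl fun s hs => ?_
    rw [Finset.sum_insert ha]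
    have e : ∑ i ∈ t, signPattern (insert a s) i * v i = ∑ i ∈ t, signPattern s i * v i := by
      refine Finset.sum_congr rfl fun i hi => ?_
      have : i ≠ a := fun h => ha (h ▸ hi)
      simp [signPattern, this]
    rw [e]
    simp only [signPattern, Finset.mem_insert_self, if_true]
    congr 1; ring

theorem sum_signPattern_sq (t : Finset ι) (v : ι → ℝ) :
    ∑ s ∈ t.powerset, (∑ i ∈ t, signPattern s i * v i) ^ 2 = 2 ^ t.card * ∑ i ∈ t, v i ^ 2 := by
  induction t using Finset.induction_on with
  | empty => simp
  | insert a t ha ih =>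
    rw [sum_signPattern_insert a t ha v (fun x => x ^ 2)]
    have : ∀ x : ℝ, (x - v a) ^ 2 + (x + v a) ^ 2 = 2 * x ^ 2 + 2 * v a ^ 2 := fun x => by ring
    simp only [this, Finset.sum_add_distrib, ← Finset.mul_sum, ih, Finset.sum_const,
      Finset.card_powerset, Finset.card_insert_of_notMem ha, Finset.sum_insert ha, nsmul_eq_mul]
    push_cast; ring

/-- Odd terms cancel between the two signs. The mixed term `12 * v a ^ 2 * x ^ 2`, evaluated by the
second moment, is exactly the cross term allowed by the constant `3`. -/
theorem sum_signPattern_pow_four (t : Finset ι) (v : ι → ℝ) :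
    ∑ s ∈ t.powerset, (∑ i ∈ t, signPattern s i * v i) ^ 4 ≤
      3 * 2 ^ t.card * (∑ i ∈ t, v i ^ 2) ^ 2 := by
  induction t using Finset.induction_on with
  | empty => simp
  | insert a t ha ih =>
    rw [sum_signPattern_insert a t ha v (fun x => x ^ 4)]
    have : ∀ x : ℝ, (x - v a) ^ 4 + (x + v a) ^ 4 =
        2 * x ^ 4 + 12 * v a ^ 2 * x ^ 2 + 2 * v a ^ 4 := fun x => by ring
    simp only [this, Finset.sum_add_distrib, ← Finset.mul_sum, sum_signPattern_sq,
      Finset.sum_const, Finset.card_powerset, Finset.card_insert_of_notMem ha,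
      Finset.sum_insert ha, nsmul_eq_mul]
    push_cast
    have h2 : (0 : ℝ) ≤ 2 ^ t.card * v a ^ 4 := by positivity
    rw [pow_succ]
    linear_combination 2 * ih + 4 * h2

/-- Khintchine's inequality in `L¹`, with the constant `1 / 2`. -/
theorem khintchine [Fintype ι] (v : ι → ℝ) :
    2 ^ Fintype.card ι * √(∑ i, v i ^ 2) ≤
      2 * ∑ s : Finset ι, |∑ i, signPattern s i * v i| := by
  set σ := √(∑ i, v i ^ 2) with hσ
  have hσ0 : 0 ≤ σ := Real.sqrt_nonneg _
  have hs : σ ^ 2 = ∑ i, v i ^ 2 := Real.sq_sqrt (Finset.sum_nonneg fun i _ => sq_nonneg _)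
  -- A pointwise minorant of `|x|` by moments. Averaged, with second moment `σ ^ 2` and fourth at
  -- most `3 * σ ^ 4`, it gives `6 σ⁴ ≤ 12 σ³ 𝔼|x|`, whence the constant `1 / 2`.
  have hpt : ∀ x : ℝ, 9 * σ ^ 2 * x ^ 2 - x ^ 4 ≤ 12 * σ ^ 3 * |x| := by
    intro x
    have hx := abs_nonneg x
    rw [← sq_abs x, show x ^ 4 = |x| ^ 4 by rw [pow_abs]; exact (abs_of_nonneg (by positivity)).symm]
    have h1 : 0 ≤ |x| * ((|x| - 7 / 4 * σ) ^ 2 * (|x| + 7 / 2 * σ)) := by positivity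
    have h2 : 0 ≤ |x| ^ 2 * σ ^ 2 := by positivity
    have h3 : 0 ≤ |x| * σ ^ 3 := by positivity
    nlinarith
  have h2 := sum_signPattern_sq (Finset.univ : Finset ι) v
  have h4 := sum_signPattern_pow_four (Finset.univ : Finset ι) v
  rw [Finset.powerset_univ, Finset.card_univ, ← hs] at h2 h4
  have hsum := Finset.sum_le_sum (s := (Finset.univ : Finset (Finset ι)))
    fun s _ => hpt (∑ i, signPattern s i * v i)
  rw [Finset.sum_sub_distrib, ← Finset.mul_sum, ← Finset.mul_sum, h2] at hsum
  rcases hσ0.eq_or_lt with h | h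
  · rw [← h]; simp only [mul_zero]; positivity
  · have h3 : 0 < σ ^ 3 := by positivity
    refine le_of_mul_le_mul_left ?_ h3
    nlinarith

end Khintchine

/-! ### A zonotope of sign vectors around the Euclidean ball. -/

section Zonotope

variable {n : ℕ}

/-- The sign pattern as a vector of Euclidean space. -/
noncomputable def signVector (s : Finset (Fin n)) : EuclideanSpace ℝ (Fin n) :=
  WithLp.toLp 2 (signPattern s)

theorem inner_signVector (s : Finset (Fin n)) (v : EuclideanSpace ℝ (Fin n)) :
    inner ℝ v (signVector s) = ∑ i, signPattern s i * v i := by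
  simp [signVector, PiLp.inner_apply]

/-- Cauchy–Schwarz over the `2 ^ n` sign patterns and the second moment. Together with the reverse
bound below, the average over sign vectors recovers the norm up to a factor independent of `n`;
coordinate directions would lose `√n`. -/
theorem sum_abs_inner_signVector_le (v : EuclideanSpace ℝ (Fin n)) :
    ∑ s : Finset (Fin n), |inner ℝ v (signVector s)| ≤ 2 ^ n * ‖v‖ := by
  have h2 := sum_signPattern_sq (Finset.univ : Finset (Fin n)) v
  rw [Finset.powerset_univ, Finset.card_univ, Fintype.card_fin] at h2
  have hn : ∑ i, v i ^ 2 = ‖v‖ ^ 2 := by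
    rw [EuclideanSpace.norm_sq_eq]; simp
  rw [hn] at h2
  have cs := sq_sum_le_card_mul_sum_sq (s := (Finset.univ : Finset (Finset (Fin n))))
    (f := fun s => |inner ℝ v (signVector s)|)
  simp only [sq_abs, inner_signVector, h2, Finset.card_univ, Fintype.card_finset,
    Fintype.card_fin] at cs
  simp only [inner_signVector]
  refine le_of_sq_le_sq ?_ (by positivity)
  push_cast at cs
  calc _ ≤ _ := cs
    _ = _ := by ring

theorem norm_le_sum_abs_inner_signVector (v : EuclideanSpace ℝ (Fin n)) :
    2 ^ n * ‖v‖ ≤ 2 * ∑ s : Finset (Fin n), |inner ℝ v (signVector s)| := by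
  have h := khintchine (fun i => v i)
  rw [Fintype.card_fin] at h
  simp only [inner_signVector]
  convert h using 2
  rw [EuclideanSpace.norm_eq]; simp

theorem mem_sum_segment {F ι : Type*} [AddCommGroup F] [Module ℝ F] (s : Finset ι) (w : ι → F)
    (t : ι → ℝ) (ht : ∀ i ∈ s, t i ∈ Icc (0 : ℝ) 1) :
    ∑ i ∈ s, t i • w i ∈ ∑ i ∈ s, segment ℝ (0 : F) (w i) := by
  refine Set.finsetSum_mem_finsetSum _ _ _ fun i hi => ?_
  rw [segment_eq_image]
  exact ⟨t i, ht i hi, by simp⟩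

theorem isCompact_sum_segment {F ι : Type*} [NormedAddCommGroup F] [NormedSpace ℝ F]
    (s : Finset ι) (w : ι → F) : IsCompact (∑ i ∈ s, segment ℝ (0 : F) (w i)) := by
  classical
  induction s using Finset.induction_on with
  | empty => simp
  | insert i s hi ih =>
    rw [Finset.sum_insert hi]
    refine IsCompact.add ?_ ih
    rw [segment_eq_image]
    exact isCompact_Icc.image (by fun_prop)

/-- The Euclidean unit ball lies in a zonotope generated by the sign vectors. -/
theorem closedBall_subset_zonotope :
    Metric.closedBall (0 : EuclideanSpace ℝ (Fin n)) 1 ⊆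
      ∑ s : Finset (Fin n), segment ℝ 0 ((4 / 2 ^ n : ℝ) • signVector s) := by
  intro x hx
  by_contra hxZ
  obtain ⟨f, u, hf, hu⟩ := geometric_hahn_banach_closed_point
    (convex_sum_segment Finset.univ fun s : Finset (Fin n) => (4 / 2 ^ n : ℝ) • signVector s)
    (isCompact_sum_segment _ _).isClosed hxZ
  set v := (InnerProductSpace.toDual ℝ (EuclideanSpace ℝ (Fin n))).symm f with hv
  have hfv : ∀ y, f y = inner ℝ v y := fun y => by
    rw [hv, InnerProductSpace.toDual_symm_apply]
  -- The point of the zonotope maximizing `f`: keep the generators on which `f` is nonnegative.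
  have hz := hf _ (mem_sum_segment Finset.univ _
    (fun s => if 0 ≤ (inner ℝ v (signVector s) : ℝ) then (1 : ℝ) else 0)
    (fun s _ => by split_ifs <;> simp))
  rw [map_sum] at hz
  have e : ∀ s : Finset (Fin n), f ((if 0 ≤ (inner ℝ v (signVector s) : ℝ) then (1 : ℝ) else 0) •
      ((4 / 2 ^ n : ℝ) • signVector s)) =
      4 / 2 ^ n * ((|inner ℝ v (signVector s)| + inner ℝ v (signVector s)) / 2) := by
    intro s
    rw [map_smul, map_smul, hfv]
    split_ifs with h
    · rw [abs_of_nonneg h, smul_eq_mul, smul_eq_mul]; ring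
    · rw [abs_of_neg (not_le.1 h), smul_eq_mul, smul_eq_mul]; ring
  -- Complementing `s` flips all signs. Hence the positive parts add up to half of the absolute
  -- values; with the `2` of Khintchine's inequality this explains the scaling `4 / 2 ^ n`.
  have hsum0 : ∑ s : Finset (Fin n), (inner ℝ v (signVector s) : ℝ) = 0 := by
    have : ∑ s : Finset (Fin n), (inner ℝ v (signVector s) : ℝ) =
        ∑ s : Finset (Fin n), -(inner ℝ v (signVector s) : ℝ) := by
      refine Finset.sum_equiv (Function.Involutive.toPerm compl compl_involutive) (by simp) ?_
      intro s _
      simp only [inner_signVector, ← Finset.sum_neg_distrib]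
      refine Finset.sum_congr rfl fun i _ => ?_
      by_cases h : i ∈ s <;> simp [signPattern, h]
    rw [Finset.sum_neg_distrib] at this
    linarith
  simp only [e] at hz
  rw [← Finset.mul_sum, ← Finset.sum_div, Finset.sum_add_distrib, hsum0, add_zero] at hz
  have hk := norm_le_sum_abs_inner_signVector v
  have hx1 : f x ≤ ‖v‖ := by
    rw [hfv]
    refine (real_inner_le_norm _ _).trans ?_
    have : ‖x‖ ≤ 1 := by simpa using hx
    nlinarith [norm_nonneg v]
  have h2 : (0 : ℝ) < 2 ^ n := by positivity
  have : ‖v‖ ≤ 4 / 2 ^ n * ((∑ s : Finset (Fin n), |inner ℝ v (signVector s)|) / 2) := by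
    rw [div_mul_eq_mul_div, le_div_iff₀ h2]
    linarith
  linarith

end Zonotope

/-! ### Determinants, Hadamard's inequality, volume-preserving maps. -/

section LinearAlgebra

variable {n : ℕ}

/-- The determinant of `n` vectors of `ℝⁿ`. -/
noncomputable def vecDet (v : Fin n → EuclideanSpace ℝ (Fin n)) : ℝ :=
  (EuclideanSpace.basisFun (Fin n) ℝ).toBasis.det v

theorem vecDet_eq_sum (v : Fin n → EuclideanSpace ℝ (Fin n)) :
    vecDet v = ∑ σ : Equiv.Perm (Fin n), ((Equiv.Perm.sign σ : ℤ) : ℝ) * ∏ i, v i (σ i) := by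
  rw [vecDet, Module.Basis.det_apply, Matrix.det_apply']
  rfl

/-- Hadamard's inequality, read off from the volume form. -/
theorem abs_vecDet_le (v : Fin n → EuclideanSpace ℝ (Fin n)) : |vecDet v| ≤ ∏ i, ‖v i‖ := by
  have : Fact (Module.finrank ℝ (EuclideanSpace ℝ (Fin n)) = n) := ⟨by simp⟩
  let o := (EuclideanSpace.basisFun (Fin n) ℝ).toBasis.orientation
  rw [vecDet, ← o.volumeForm_robust']
  exact o.abs_volumeForm_apply_le v

theorem vecDet_comp (A : EuclideanSpace ℝ (Fin n) →L[ℝ] EuclideanSpace ℝ (Fin n))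
    (v : Fin n → EuclideanSpace ℝ (Fin n)) :
    vecDet (fun i => A (v i)) = A.det * vecDet v :=
  (EuclideanSpace.basisFun (Fin n) ℝ).toBasis.det_comp A.toLinearMap v

theorem det_adjoint_eq (A : EuclideanSpace ℝ (Fin n) →L[ℝ] EuclideanSpace ℝ (Fin n)) :
    (ContinuousLinearMap.adjoint A).det = A.det := by
  let b := EuclideanSpace.basisFun (Fin n) ℝ
  rw [ContinuousLinearMap.det, ContinuousLinearMap.det, ← LinearMap.det_toMatrix b.toBasis,
    ← LinearMap.det_toMatrix b.toBasis A.toLinearMap, ← Matrix.det_transpose]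
  congr 1
  ext i j
  simp only [Matrix.transpose_apply, LinearMap.toMatrix_apply, OrthonormalBasis.coe_toBasis,
    OrthonormalBasis.coe_toBasis_repr_apply, ContinuousLinearMap.coe_coe,
    OrthonormalBasis.repr_apply_apply]
  rw [ContinuousLinearMap.adjoint_inner_right, real_inner_comm]

/-- The adjoint sends the basis vectors to the rows of `A`, so this is Hadamard's inequality for
rows. -/
theorem abs_det_le_prod_norm_rows (A : EuclideanSpace ℝ (Fin n) →L[ℝ] EuclideanSpace ℝ (Fin n)) :
    |A.det| ≤ ∏ i, ‖ContinuousLinearMap.adjoint A (EuclideanSpace.single i 1)‖ := by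
  refine le_trans (le_of_eq ?_) (abs_vecDet_le _)
  rw [vecDet_comp, det_adjoint_eq]
  have : vecDet (fun i : Fin n => EuclideanSpace.single i (1 : ℝ)) = 1 := by
    have := (EuclideanSpace.basisFun (Fin n) ℝ).toBasis.det_self
    rw [vecDet]
    convert this using 2
    ext i
    simp
  rw [this, mul_one]

theorem card_le_sum_of_one_le_prod {z : Fin n → ℝ} (hz : ∀ i, 0 ≤ z i) (h : 1 ≤ ∏ i, z i) :
    (n : ℝ) ≤ ∑ i, z i := by
  rcases Nat.eq_zero_or_pos n with rfl | hn
  · simp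
  have hn' : (0 : ℝ) < n := by exact_mod_cast hn
  have := Real.geom_mean_le_arith_mean (Finset.univ : Finset (Fin n)) (fun _ => 1) z
    (fun _ _ => zero_le_one) (by simpa using hn') (fun i _ => hz i)
  simp only [Real.rpow_one, Finset.sum_const, Finset.card_univ, Fintype.card_fin, nsmul_eq_mul,
    mul_one, one_mul] at this
  have h1 : (1 : ℝ) ≤ (∏ i, z i) ^ (n : ℝ)⁻¹ := Real.one_le_rpow h (by positivity)
  have := h1.trans this
  rwa [le_div_iff₀ hn', one_mul] at this

theorem abs_det_eq_one_of_measurePreserving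
    {T : EuclideanSpace ℝ (Fin n) →ₗ[ℝ] EuclideanSpace ℝ (Fin n)}
    (hT : MeasurePreserving T volume volume) : |LinearMap.det T| = 1 := by
  set b := Metric.closedBall (0 : EuclideanSpace ℝ (Fin n)) 1
  have hb : IsCompact b := isCompact_closedBall _ _
  have hb0 : volume b ≠ 0 := (Metric.measure_closedBall_pos _ _ one_pos).ne'
  have hbi : volume b ≠ ∞ := hb.measure_ne_top
  -- A singular `T` would map the ball to a null set whose preimage contains the ball.
  have hdet : LinearMap.det T ≠ 0 := by
    intro h0
    have him : MeasurableSet (T '' b) :=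
      (hb.image T.continuous_of_finiteDimensional).measurableSet
    have h1 := hT.measure_preimage him.nullMeasurableSet
    rw [Measure.addHaar_image_linearMap, h0, abs_zero, ENNReal.ofReal_zero, zero_mul] at h1
    exact hb0 (measure_mono_null (subset_preimage_image T b) h1)
  have h2 := hT.measure_preimage hb.measurableSet.nullMeasurableSet
  rw [Measure.addHaar_preimage_linearMap _ hdet] at h2
  have h3 : ENNReal.ofReal |(LinearMap.det T)⁻¹| = 1 := by
    have := (ENNReal.mul_eq_right hb0 hbi).1 h2
    exact this
  rw [ENNReal.ofReal_eq_one, abs_inv, inv_eq_one] at h3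
  exact h3

theorem measurePreserving_of_abs_det_eq_one
    {T : EuclideanSpace ℝ (Fin n) →ₗ[ℝ] EuclideanSpace ℝ (Fin n)}
    (hT : |LinearMap.det T| = 1) : MeasurePreserving T volume volume := by
  have h0 : LinearMap.det T ≠ 0 := fun h => by simp [h] at hT
  refine ⟨T.continuous_of_finiteDimensional.measurable, ?_⟩
  rw [Measure.map_linearMap_addHaar_eq_smul_addHaar _ h0, abs_inv, hT]
  simp

end LinearAlgebra

/-! ### The cube: normalization and upper bound. -/

section Cube

variable {n : ℕ}

theorem volume_coordinate_box (s : Fin n → Set ℝ) :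
    volume {x : EuclideanSpace ℝ (Fin n) | ∀ i, x i ∈ s i} = ∏ i, volume (s i) := by
  rw [← volume_pi_pi, ← (EuclideanSpace.volume_preserving_symm_measurableEquiv_toLp
    (Fin n)).measure_preimage_equiv]
  congr 1
  ext x
  simp [Set.mem_pi]
  
theorem cube_eq : cube n = {x | ∀ i, x i ∈ Icc (-1 : ℝ) 1} := by
  ext x; simp [cube, abs_le]

theorem volume_cube : volume (cube n) = 2 ^ n := by
  rw [cube_eq, volume_coordinate_box]
  norm_num

theorem isClosed_cube : IsClosed (cube n) := by
  rw [cube_eq, ofPred_forall]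
  exact isClosed_iInter fun i => isClosed_Icc.preimage (by fun_prop)

theorem ofReal_uniformDensity_cube (x : EuclideanSpace ℝ (Fin n)) :
    ENNReal.ofReal (uniformDensity (cube n) x) = (cube n).indicator (fun _ => (2 ^ n)⁻¹) x := by
  have : ENNReal.ofReal ((volume.real (cube n))⁻¹) = (2 ^ n)⁻¹ := by
    rw [measureReal_def, volume_cube, ENNReal.ofReal_inv_of_pos (by simp),
      ENNReal.ofReal_toReal (by simp)]
  by_cases h : x ∈ cube n <;> simp [uniformDensity, h, this]

theorem eLpNorm_uniformDensity_cube :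
    eLpNorm (uniformDensity (cube n)) ∞ volume = (2 ^ n)⁻¹ := by
  have h0 : volume (cube n) ≠ 0 := by rw [volume_cube]; positivity
  rw [uniformDensity, eLpNorm_indicator_const' isClosed_cube.measurableSet h0 (by simp),
    ENNReal.toReal_top, div_zero, ENNReal.rpow_zero, mul_one, measureReal_def, volume_cube,
    ← ENNReal.toReal_inv, Real.enorm_of_nonneg (by positivity), ENNReal.ofReal_toReal (by simp)]

/-- Reduces both claims about the cube to comparisons with `n`. For `n = 0` the factor `n` makes the
value of the power irrelevant. -/
theorem two_mul_card_mul_norm_cube :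
    2 * (n : ℝ≥0∞) * eLpNorm (uniformDensity (cube n)) ∞ volume ^ (1 / (n : ℝ)) = n := by
  rcases Nat.eq_zero_or_pos n with rfl | hn
  · simp
  rw [eLpNorm_uniformDensity_cube, ENNReal.inv_rpow, ← ENNReal.rpow_natCast, ← ENNReal.rpow_mul,
    mul_one_div_cancel (by positivity), ENNReal.rpow_one, mul_comm 2, mul_assoc,
    ENNReal.mul_inv_cancel (by simp) (by simp), mul_one]

theorem volume_slab (i : Fin n) (S T : Set ℝ) :
    volume {x : EuclideanSpace ℝ (Fin n) | x i ∈ S ∧ ∀ j ≠ i, x j ∈ T} =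
      volume S * volume T ^ (n - 1) := by
  have h := volume_coordinate_box (Function.update (fun _ => T) i S)
  rw [← Finset.mul_prod_erase _ _ (Finset.mem_univ i), Function.update_self,
    Finset.prod_congr rfl (g := fun _ => volume T) (fun j hj => by
      rw [Function.update_of_ne (Finset.ne_of_mem_erase hj)]),
    Finset.prod_const, Finset.card_erase_of_mem (Finset.mem_univ i), Finset.card_univ,
    Fintype.card_fin] at h
  rw [← h]
  congr 1
  ext x
  constructor
  · rintro ⟨h1, h2⟩ j
    by_cases hj : j = i
    · subst hj; simpa using h1
    · simpa [hj] using h2 j hj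
  · intro hx
    refine ⟨by simpa using hx i, fun j hj => by simpa [hj] using hx j⟩

theorem smul_sum_segment_subset {F ι : Type*} [AddCommGroup F] [Module ℝ F] (s : Finset ι)
    (w : ι → F) (c : ℝ) :
    c • ∑ i ∈ s, segment ℝ (0 : F) (w i) ⊆ ∑ i ∈ s, segment ℝ (0 : F) (c • w i) := by
  rintro _ ⟨y, hy, rfl⟩
  obtain ⟨g, hg, rfl⟩ := (Set.mem_finsetSum _ _ _).1 hy
  simp only [Finset.smul_sum]
  refine Set.finsetSum_mem_finsetSum _ _ _ fun i hi => ?_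
  have := hg hi
  rw [segment_eq_image] at this ⊢
  obtain ⟨t, ht, h⟩ := this
  refine ⟨t, ht, ?_⟩
  simp only [smul_zero, zero_add] at h ⊢
  rw [← h, smul_comm]

/-- Sweeping estimates hold at every scale `ε`, so no limit has to be computed for upper bounds. -/
theorem perimeter_le_of_forall {μ : Measure (EuclideanSpace ℝ (Fin n))}
    {Q : Set (EuclideanSpace ℝ (Fin n))} {c : ℝ≥0∞}
    (h : ∀ ε : ℝ, 0 < ε →
      μ ((Q + ε • Metric.closedBall (0 : EuclideanSpace ℝ (Fin n)) 1) \ Q) ≤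
        ENNReal.ofReal ε * c) : perimeter μ Q ≤ c := by
  refine Filter.liminf_le_of_frequently_le' (Eventually.frequently ?_)
  filter_upwards [self_mem_nhdsWithin] with ε hε
  refine ENNReal.div_le_of_le_mul ?_
  rw [mul_comm]
  exact h ε hε

/-- The generators `e_i`, `-e_i` of the cube as a zonotope. -/
noncomputable def cubeGenerator (p : Fin n × Bool) : EuclideanSpace ℝ (Fin n) :=
  EuclideanSpace.single p.1 (if p.2 then 1 else -1)

/-- Each pair `e_i`, `-e_i` generates `[-1, 1]` on the `i`-th axis, with the positive and negative
parts of `x i` as coefficients. These generators, aligned with the faces, give the sharp constant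
for the cube. -/
theorem closedBall_subset_cubeGenerator :
    Metric.closedBall (0 : EuclideanSpace ℝ (Fin n)) 1 ⊆
      ∑ p : Fin n × Bool, segment ℝ 0 (cubeGenerator p) := by
  intro x hx
  have hx1 : ∀ i, |x i| ≤ 1 := fun i => by
    have := PiLp.norm_apply_le x i
    rw [Real.norm_eq_abs] at this
    exact this.trans (by simpa using hx)
  convert mem_sum_segment Finset.univ (cubeGenerator (n := n))
    (fun p => if p.2 then max (x p.1) 0 else max (-x p.1) 0) (fun p _ => ?_) using 1
  · ext j
    rw [Fintype.sum_prod_type]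
    simp only [cubeGenerator, Fintype.sum_bool, if_true, Bool.false_eq_true, if_false]
    rw [WithLp.ofLp_sum, Finset.sum_apply, Finset.sum_eq_single j]
    · rcases le_total 0 (x j) with h | h <;> simp [h]
    · intro i _ hij
      simp [hij.symm]
    · simp
  · have := abs_le.1 (hx1 p.1)
    split_ifs
    · exact ⟨le_max_right _ _, max_le this.2 zero_le_one⟩
    · exact ⟨le_max_right _ _, max_le (by linarith [this.1]) zero_le_one⟩

/-- The density drops only from a slab of thickness `ε` along one face; it has volume at most `ε * 2
^ (n - 1)` and carries density `2⁻ⁿ`. -/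
theorem lintegral_increment_cube_le (p : Fin n × Bool) {ε : ℝ} (hε : 0 < ε) :
    ∫⁻ x : EuclideanSpace ℝ (Fin n), ((cube n).indicator (fun _ => (2 ^ n : ℝ≥0∞)⁻¹) x -
      (cube n).indicator (fun _ => (2 ^ n)⁻¹) (x + ε • cubeGenerator p)) ≤
      ENNReal.ofReal ε / 2 := by
  obtain ⟨i, b⟩ := p
  have hn : 1 ≤ n := i.pos
  let S : Set ℝ := if b then Ioc (1 - ε) 1 else Ico (-1) (-1 + ε)
  have hS : volume S = ENNReal.ofReal ε := by
    by_cases h : b <;> simp [S, h]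
  have hSm : MeasurableSet S := by
    by_cases h : b <;> simp [S, h]
  set D : Set (EuclideanSpace ℝ (Fin n)) := {x | x i ∈ S ∧ ∀ j ≠ i, x j ∈ Icc (-1 : ℝ) 1}
  have hD : volume D = ENNReal.ofReal ε * 2 ^ (n - 1) := by
    rw [volume_slab, hS]; norm_num
  have hle : ∀ x : EuclideanSpace ℝ (Fin n), (cube n).indicator (fun _ => (2 ^ n : ℝ≥0∞)⁻¹) x -
      (cube n).indicator (fun _ => (2 ^ n)⁻¹) (x + ε • cubeGenerator (i, b)) ≤
      D.indicator (fun _ => (2 ^ n : ℝ≥0∞)⁻¹) x := by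
    intro x
    by_cases hx : x ∈ cube n
    · by_cases hx' : x + ε • cubeGenerator (i, b) ∈ cube n
      · simp [hx, hx']
      · have hxD : x ∈ D := by
          rw [cube_eq] at hx hx'
          refine ⟨?_, fun j _ => hx j⟩
          simp only [mem_ofPred_eq, not_forall] at hx'
          obtain ⟨j, hj⟩ := hx'
          have hxj := hx j
          have hxi := hx i
          by_cases hji : j = i
          · subst hji
            cases b
            · simp [cubeGenerator] at hj hxj
              simp only [S, Bool.false_eq_true, if_false, mem_Ico]
              refine ⟨hxj.1, ?_⟩
              by_contra hc
              have := hj (by linarith)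
              linarith [hxj.2]
            · simp [cubeGenerator] at hj hxj
              simp only [S, if_true, mem_Ioc]
              refine ⟨?_, hxj.2⟩
              have := hj (by linarith [hxj.1])
              linarith
          · exfalso
            apply hj
            simpa [cubeGenerator, hji] using hxj
        simp [hx, hx', hxD]
    · simp [hx]
  refine (lintegral_mono hle).trans ((lintegral_indicator_const_le _ _).trans ?_)
  rw [hD]
  obtain ⟨k, rfl⟩ : ∃ k, n = k + 1 := ⟨n - 1, by omega⟩
  rw [Nat.add_sub_cancel, pow_succ, ENNReal.mul_inv (by simp) (by simp), div_eq_mul_inv]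
  calc _ = ENNReal.ofReal ε * 2⁻¹ * ((2 ^ k)⁻¹ * 2 ^ k) := by ring
    _ = ENNReal.ofReal ε * 2⁻¹ := by rw [ENNReal.inv_mul_cancel (by simp) (by simp), mul_one]
    _ ≤ _ := le_rfl

theorem maxPerimeter_cube_le :
    maxPerimeter ((volume : Measure (EuclideanSpace ℝ (Fin n))).withDensity
      ((cube n).indicator fun _ => (2 ^ n)⁻¹)) ≤ n := by
  refine iSup₂_le fun Q hQ => perimeter_le_of_forall fun ε hε => ?_
  have hsub : (Q + ε • Metric.closedBall (0 : EuclideanSpace ℝ (Fin n)) 1) \ Q ⊆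
      (Q + ∑ p : Fin n × Bool, segment ℝ 0 (ε • cubeGenerator p)) \ Q :=
    sdiff_subset_sdiff_left (add_subset_add_left
      ((smul_set_mono closedBall_subset_cubeGenerator).trans (smul_sum_segment_subset _ _ _)))
  have hm : Measurable ((cube n).indicator fun _ => (2 ^ n : ℝ≥0∞)⁻¹) :=
    measurable_const.indicator isClosed_cube.measurableSet
  refine (measure_mono hsub).trans ?_
  rw [withDensity_apply']
  refine (setLIntegral_zonotope_le volume Finset.univ _ hQ hm.aemeasurable ?_).trans ?_
  · rw [lintegral_indicator_const isClosed_cube.measurableSet, volume_cube,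
      ENNReal.inv_mul_cancel (by simp) (by simp)]
    simp
  · refine (Finset.sum_le_sum fun p _ => lintegral_increment_cube_le p hε).trans ?_
    simp only [Finset.sum_const, Finset.card_univ, Fintype.card_prod, Fintype.card_fin,
      Fintype.card_bool, nsmul_eq_mul, Nat.cast_mul, Nat.cast_ofNat]
    rw [mul_assoc, ENNReal.mul_div_cancel (by simp) (by simp), mul_comm]

end Cube

/-! ### The cube: lower bound for every volume-preserving image. -/

section CubeLower

variable {n : ℕ}

theorem le_volume_abs_Ioc {s δ : ℝ} (hs : 0 ≤ s) (hδ : 0 ≤ δ) :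
    ENNReal.ofReal (2 * δ) ≤ volume {t : ℝ | s < |t| ∧ |t| ≤ s + δ} := by
  have hd : Disjoint (Ico (-(s + δ)) (-s)) (Ioc s (s + δ)) := by
    rw [Set.disjoint_left]
    rintro x ⟨-, h1⟩ ⟨h2, -⟩
    linarith
  calc ENNReal.ofReal (2 * δ) = volume (Ico (-(s + δ)) (-s) ∪ Ioc s (s + δ)) := by
        rw [measure_union hd measurableSet_Ioc, Real.volume_Ico, Real.volume_Ioc,
          ← ENNReal.ofReal_add (by linarith) (by linarith)]
        congr 1; ring
    _ ≤ _ := by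
        refine measure_mono ?_
        rintro t (⟨h1, h2⟩ | ⟨h1, h2⟩)
        · have : t < 0 := by linarith
          simp only [mem_ofPred_eq, abs_of_neg this]
          constructor <;> linarith
        · have : 0 < t := by linarith
          simp only [mem_ofPred_eq, abs_of_pos this]
          constructor <;> linarith

/-- The centrally symmetric cube of half side `s`. -/
def cubeOfRadius (n : ℕ) (s : ℝ) : Set (EuclideanSpace ℝ (Fin n)) := {x | ∀ i, |x i| ≤ s}

theorem cubeOfRadius_eq (s : ℝ) : cubeOfRadius n s = {x | ∀ i, x i ∈ Icc (-s) s} := by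
  ext x; simp [cubeOfRadius, abs_le]

theorem isClosed_cubeOfRadius (s : ℝ) : IsClosed (cubeOfRadius n s) := by
  rw [cubeOfRadius_eq, ofPred_forall]
  exact isClosed_iInter fun i => isClosed_Icc.preimage (by fun_prop)

theorem convex_cubeOfRadius (s : ℝ) : Convex ℝ (cubeOfRadius n s) := by
  rw [cubeOfRadius_eq]
  intro x hx y hy a b ha hb hab i
  exact (convex_Icc (-s) s) (hx i) (hy i) ha hb hab

/-- The part of a neighbourhood of the cube of half side `s` lying over the two faces orthogonal
to the `i`-th axis, of height `δ`, the faces being shrunk to half side `r`. -/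
def faceSlab (i : Fin n) (s δ r : ℝ) : Set (EuclideanSpace ℝ (Fin n)) :=
  {x | x i ∈ {t : ℝ | s < |t| ∧ |t| ≤ s + δ} ∧ ∀ j ≠ i, x j ∈ Icc (-r) r}

theorem measurableSet_faceSlab (i : Fin n) (s δ r : ℝ) : MeasurableSet (faceSlab i s δ r) := by
  have h1 : MeasurableSet {t : ℝ | s < |t| ∧ |t| ≤ s + δ} :=
    (measurableSet_lt measurable_const measurable_norm).inter
      (measurableSet_le measurable_norm measurable_const)
  have : faceSlab i s δ r = (fun x : EuclideanSpace ℝ (Fin n) => x i) ⁻¹'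
      {t : ℝ | s < |t| ∧ |t| ≤ s + δ} ∩ ⋂ j, ⋂ (_ : j ≠ i),
        (fun x : EuclideanSpace ℝ (Fin n) => x j) ⁻¹' Icc (-r) r := by
    ext x; simp [faceSlab]
  rw [this]
  refine (h1.preimage (by fun_prop)).inter (MeasurableSet.iInter fun j => MeasurableSet.iInter
    fun _ => measurableSet_Icc.preimage (by fun_prop))

theorem le_volume_faceSlab (i : Fin n) {s δ r : ℝ} (hs : 0 ≤ s) (hδ : 0 ≤ δ) (hr : 0 ≤ r) :
    ENNReal.ofReal (2 ^ n * (δ * r ^ (n - 1))) ≤ volume (faceSlab i s δ r) := by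
  rw [faceSlab, volume_slab, Real.volume_Icc, ← ENNReal.ofReal_pow (by linarith)]
  have hn : n = (n - 1) + 1 := by have := i.pos; omega
  calc _ = ENNReal.ofReal (2 * δ) * ENNReal.ofReal ((r - -r) ^ (n - 1)) := by
        rw [← ENNReal.ofReal_mul (by linarith)]
        congr 1
        rw [sub_neg_eq_add, ← two_mul, mul_pow]
        conv_lhs => rw [hn, pow_succ]
        simp only [Nat.add_sub_cancel]
        ring
    _ ≤ _ := by gcongr; exact le_volume_abs_Ioc hs hδ

/-- The slabs over the faces of a cube lie in its anisotropic neighbourhoods. -/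
theorem faceSlab_subset (e : EuclideanSpace ℝ (Fin n) ≃L[ℝ] EuclideanSpace ℝ (Fin n))
    (i : Fin n) {s ε r : ℝ} (hs : 0 ≤ s) (hε : 0 < ε)
    (r' : EuclideanSpace ℝ (Fin n)) (hr' : ∀ x, inner ℝ r' x = e.symm x i)
    (hr : r + ε * ‖e.symm (‖r'‖⁻¹ • r')‖ ≤ s) :
    faceSlab i s (ε * ‖r'‖) r ⊆ e ⁻¹' ((e.symm ⁻¹' cubeOfRadius n s +
      ε • Metric.closedBall (0 : EuclideanSpace ℝ (Fin n)) 1) \ (e.symm ⁻¹' cubeOfRadius n s)) := by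
  rintro x ⟨⟨hx1, hx2⟩, hx3⟩
  set h := ‖r'‖ with hh
  have hpos : 0 < h := by
    by_contra hc
    have : ε * h ≤ 0 := mul_nonpos_of_nonneg_of_nonpos hε.le (not_lt.1 hc)
    linarith
  -- The unit normal of the image of the face. Sliding back along `p = e.symm u` by `θ ≤ ε` changes
  -- the `i`-th coordinate by `θ * h`, enough to return to the cube; the drift in the other
  -- coordinates is at most `ε * ‖p‖`, which `hr` leaves room for.
  set u := h⁻¹ • r' with hu
  have hu1 : ‖u‖ = 1 := by rw [hu, norm_smul, norm_inv, norm_norm, ← hh, inv_mul_cancel₀ hpos.ne']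
  set p := e.symm u with hp
  have hpi : p i = h := by
    rw [hp, ← hr', hu, inner_smul_right, real_inner_self_eq_norm_sq, ← hh]
    field_simp
  obtain ⟨σ, hσ1, hσx⟩ : ∃ σ : ℝ, |σ| = 1 ∧ x i = σ * |x i| := by
    rcases le_total 0 (x i) with hx0 | hx0
    · exact ⟨1, by simp, by rw [abs_of_nonneg hx0, one_mul]⟩
    · exact ⟨-1, by simp, by rw [abs_of_nonpos hx0]; ring⟩
  set θ := (|x i| - s) / h with hθ
  have hθ0 : 0 < θ := div_pos (by linarith) hpos
  have hθε : θ ≤ ε := by rw [hθ, div_le_iff₀ hpos]; linarith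
  refine ⟨⟨e (x - (σ * θ) • p), ?_, (σ * θ) • u, ?_, ?_⟩, ?_⟩
  · intro j
    rw [ContinuousLinearEquiv.symm_apply_apply]
    by_cases hj : j = i
    · subst hj
      have : (x - (σ * θ) • p) j = σ * s := by
        have hθh : θ * h = |x j| - s := by rw [hθ]; field_simp
        rw [PiLp.sub_apply, PiLp.smul_apply, hpi, smul_eq_mul]
        linear_combination hσx - σ * hθh
      rw [this, abs_mul, hσ1, abs_of_nonneg hs, one_mul]
    · have h1 := hx3 j hj
      have h2 : |p j| ≤ ‖p‖ := PiLp.norm_apply_le p j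
      have h3 : |(σ * θ) * p j| ≤ ε * ‖p‖ := by
        rw [abs_mul, abs_mul, hσ1, one_mul, abs_of_pos hθ0]
        gcongr
      rw [PiLp.sub_apply, PiLp.smul_apply, smul_eq_mul]
      refine (abs_sub _ _).trans ?_
      have : |x j| ≤ r := abs_le.2 h1
      linarith
  · refine ⟨ε⁻¹ • (σ * θ) • u, ?_, by simp [smul_smul, hε.ne']⟩
    rw [mem_closedBall_zero_iff, norm_smul, norm_smul, hu1, mul_one, norm_inv, Real.norm_eq_abs,
      Real.norm_eq_abs, abs_mul, hσ1, one_mul, abs_of_pos hε, abs_of_pos hθ0, inv_mul_le_iff₀ hε]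
    linarith
  · simp [hp]
  · intro hc
    have := hc i
    rw [ContinuousLinearEquiv.symm_apply_apply] at this
    linarith

/-- For the image under `T` of a slightly smaller cube, the slabs over the `i`-th pair of faces have
mass at least `ε * ‖row i‖ * r ^ (n - 1)`. The rows of the inverse have norms of product at least
`1`, hence of sum at least `n`; finally `r → 1`. -/
theorem card_le_maxPerimeter_map_cube
    {T : EuclideanSpace ℝ (Fin n) →ₗ[ℝ] EuclideanSpace ℝ (Fin n)}
    (hT : MeasurePreserving T volume volume) :
    (n : ℝ≥0∞) ≤ maxPerimeter (((volume : Measure (EuclideanSpace ℝ (Fin n))).withDensity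
      ((cube n).indicator fun _ => (2 ^ n)⁻¹)).map T) := by
  have hdet := abs_det_eq_one_of_measurePreserving hT
  have hdet0 : LinearMap.det T ≠ 0 := fun h => by simp [h] at hdet
  let e := (T.equivOfDetNeZero hdet0).toContinuousLinearEquiv
  have heT : ∀ x, e x = T x := fun x => rfl
  let S : EuclideanSpace ℝ (Fin n) →L[ℝ] EuclideanSpace ℝ (Fin n) := e.symm
  have hSdet : |S.det| = 1 := by
    have h1 : LinearMap.det (S : EuclideanSpace ℝ (Fin n) →ₗ[ℝ] EuclideanSpace ℝ (Fin n)) *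
        LinearMap.det T = 1 := by
      rw [← LinearMap.det_comp]
      have : (S : EuclideanSpace ℝ (Fin n) →ₗ[ℝ] EuclideanSpace ℝ (Fin n)) ∘ₗ T =
          LinearMap.id := by
        ext1 x
        exact e.symm_apply_apply x
      rw [this, LinearMap.det_id]
    have h2 := congrArg abs h1
    rw [abs_mul, hdet, mul_one, abs_one] at h2
    exact h2
  let row : Fin n → EuclideanSpace ℝ (Fin n) := fun i =>
    ContinuousLinearMap.adjoint S (EuclideanSpace.single i 1)
  have hrow : ∀ i x, inner ℝ (row i) x = e.symm x i := by
    intro i x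
    simp only [row]
    rw [ContinuousLinearMap.adjoint_inner_left, EuclideanSpace.inner_single_left]
    simp [S]
  have hsum : (n : ℝ) ≤ ∑ i, ‖row i‖ :=
    card_le_sum_of_one_le_prod (fun i => norm_nonneg _)
      (hSdet ▸ abs_det_le_prod_norm_rows S)
  set φ : EuclideanSpace ℝ (Fin n) → ℝ≥0∞ := (cube n).indicator fun _ => (2 ^ n)⁻¹ with hφ
  have key : ∀ r ∈ Ioo (0 : ℝ) 1, ENNReal.ofReal (n * r ^ (n - 1)) ≤
      maxPerimeter (((volume : Measure (EuclideanSpace ℝ (Fin n))).withDensity φ).map T) := by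
    rintro r ⟨hr0, hr1⟩
    -- Strictly between `r` and `1`: `r < s` absorbs the sideways drift and keeps different slabs
    -- disjoint, `s < 1` keeps the slabs inside the support.
    set s := (1 + r) / 2 with hs
    have hs0 : 0 ≤ s := by linarith
    set Q : Set (EuclideanSpace ℝ (Fin n)) := e.symm ⁻¹' cubeOfRadius n s with hQ
    have hQc : Convex ℝ Q :=
      (convex_cubeOfRadius s).is_linear_preimage (e.symm.toLinearMap.isLinear)
    have hQcl : IsClosed Q := (isClosed_cubeOfRadius s).preimage e.symm.continuous
    refine le_trans ?_ (le_iSup₂_of_le Q hQc le_rfl)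
    refine Filter.le_liminf_of_le (by isBoundedDefault) ?_
    have hκ : ∀ i, ∀ᶠ ε : ℝ in 𝓝[>] 0, r + ε * ‖e.symm (‖row i‖⁻¹ • row i)‖ ≤ s ∧
        s + ε * ‖row i‖ ≤ 1 := by
      intro i
      have hlt : r + 0 * ‖e.symm (‖row i‖⁻¹ • row i)‖ < s := by rw [zero_mul]; linarith
      have hlt' : s + 0 * ‖row i‖ < 1 := by rw [zero_mul]; linarith
      have c1 : ContinuousAt (fun ε : ℝ => r + ε * ‖e.symm (‖row i‖⁻¹ • row i)‖) 0 := by fun_prop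
      have c2 : ContinuousAt (fun ε : ℝ => s + ε * ‖row i‖) 0 := by fun_prop
      have := (c1.eventually_lt continuousAt_const hlt).and (c2.eventually_lt continuousAt_const hlt')
      filter_upwards [this.filter_mono nhdsWithin_le_nhds] with ε hε
      exact ⟨hε.1.le, hε.2.le⟩
    filter_upwards [eventually_all.2 hκ, self_mem_nhdsWithin] with ε hκε hε
    have hε' : 0 < ε := hε
    rw [ENNReal.le_div_iff_mul_le (Or.inl (by simpa using hε')) (Or.inl (by simp))]
    have hQm : MeasurableSet ((Q + ε • Metric.closedBall (0 : EuclideanSpace ℝ (Fin n)) 1) \ Q) :=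
      (hQcl.add_right_of_isCompact ((isCompact_closedBall _ _).smul ε)).measurableSet.diff
        hQcl.measurableSet
    rw [Measure.map_apply hT.measurable hQm]
    set D : Fin n → Set (EuclideanSpace ℝ (Fin n)) := fun i => faceSlab i s (ε * ‖row i‖) r
    have hDm : ∀ i, MeasurableSet (D i) := fun i => measurableSet_faceSlab _ _ _ _
    have hDsub : (⋃ i, D i) ⊆
        T ⁻¹' ((Q + ε • Metric.closedBall (0 : EuclideanSpace ℝ (Fin n)) 1) \ Q) :=
      iUnion_subset fun i => faceSlab_subset e i hs0 hε' (row i) (hrow i) (hκε i).1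
    have hDcube : (⋃ i, D i) ⊆ cube n := by
      refine iUnion_subset fun i x hx j => ?_
      by_cases hj : j = i
      · subst hj; exact hx.1.2.trans (hκε j).2
      · exact (abs_le.2 (hx.2 j hj)).trans hr1.le
    have hDdisj : Pairwise (Function.onFun Disjoint D) := by
      intro i j hij
      refine Set.disjoint_left.2 fun x hxi hxj => ?_
      have h1 := hxi.1.1
      have h2 := abs_le.2 (hxj.2 i hij)
      linarith
    refine le_trans ?_ (measure_mono hDsub)
    rw [withDensity_apply', setLIntegral_congr_fun (g := fun _ => (2 ^ n : ℝ≥0∞)⁻¹)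
      (MeasurableSet.iUnion hDm) (fun x hx => by
        simp only [hφ, indicator_of_mem (hDcube hx)]), setLIntegral_const,
      measure_iUnion hDdisj hDm, tsum_fintype]
    have h2n : (2 ^ n : ℝ≥0∞)⁻¹ = ENNReal.ofReal ((2 ^ n)⁻¹) := by
      rw [ENNReal.ofReal_inv_of_pos (by positivity), ENNReal.ofReal_pow (by norm_num)]
      norm_num
    calc ENNReal.ofReal (n * r ^ (n - 1)) * ENNReal.ofReal ε
        = ENNReal.ofReal ((n * r ^ (n - 1)) * ε) := by rw [← ENNReal.ofReal_mul (by positivity)]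
      _ ≤ ENNReal.ofReal ((2 ^ n)⁻¹ * ∑ i, 2 ^ n * ((ε * ‖row i‖) * r ^ (n - 1))) := by
          refine ENNReal.ofReal_le_ofReal ?_
          have e1 : ((2 : ℝ) ^ n)⁻¹ * ∑ i, 2 ^ n * ((ε * ‖row i‖) * r ^ (n - 1)) =
              (∑ i, ‖row i‖) * (r ^ (n - 1) * ε) := by
            rw [Finset.mul_sum, Finset.sum_mul]
            refine Finset.sum_congr rfl fun i _ => ?_
            field_simp
          rw [e1, mul_assoc]
          gcongr
      _ = ENNReal.ofReal ((2 ^ n)⁻¹) *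
          ∑ i, ENNReal.ofReal (2 ^ n * ((ε * ‖row i‖) * r ^ (n - 1))) := by
          rw [ENNReal.ofReal_mul (by positivity), ENNReal.ofReal_sum_of_nonneg]
          intro i _; positivity
      _ ≤ _ := by
          rw [h2n]
          gcongr with i
          exact le_volume_faceSlab i hs0 (by positivity) hr0.le
  have lim : Tendsto (fun r : ℝ => ENNReal.ofReal (n * r ^ (n - 1))) (𝓝[<] 1)
      (𝓝 (ENNReal.ofReal (n * 1 ^ (n - 1)))) := by
    refine (ENNReal.continuous_ofReal.tendsto _).comp ?_
    have : Continuous fun r : ℝ => (n : ℝ) * r ^ (n - 1) := by fun_prop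
    exact (this.tendsto 1).mono_left nhdsWithin_le_nhds
  rw [one_pow, mul_one, ENNReal.ofReal_natCast] at lim
  refine le_of_tendsto lim ?_
  filter_upwards [Ioo_mem_nhdsLT (zero_lt_one' ℝ)] with r hr
  exact key r hr

theorem uniform_cube_perimeter {Ω : Type*} [MeasurableSpace Ω] (P : Measure Ω)
    (X : Ω → EuclideanSpace ℝ (Fin n)) (hX : HasDensity P X (uniformDensity (cube n))) :
    Gam P X = n ∧ ∀ T : EuclideanSpace ℝ (Fin n) →ₗ[ℝ] EuclideanSpace ℝ (Fin n),
      MeasurePreserving T volume volume → (n : ℝ≥0∞) ≤ Gam P (fun ω => T (X ω)) := by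
  have hmap : P.map X = (volume : Measure (EuclideanSpace ℝ (Fin n))).withDensity
      ((cube n).indicator fun _ => (2 ^ n)⁻¹) := by
    rw [hX.hasLaw.map_eq]
    congr 1
    ext x
    exact ofReal_uniformDensity_cube x
  have low : ∀ T : EuclideanSpace ℝ (Fin n) →ₗ[ℝ] EuclideanSpace ℝ (Fin n),
      MeasurePreserving T volume volume → (n : ℝ≥0∞) ≤ Gam P (fun ω => T (X ω)) := by
    intro T hT
    have := card_le_maxPerimeter_map_cube hT
    rw [← hmap, AEMeasurable.map_map_of_aemeasurable hT.measurable.aemeasurable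
      hX.hasLaw.aemeasurable] at this
    exact this
  refine ⟨le_antisymm ?_ ?_, low⟩
  · rw [Gam, hmap]
    exact maxPerimeter_cube_le
  · exact low LinearMap.id (MeasurePreserving.id _)

end CubeLower

/-! ### Increments of a Lipschitz function and its gradient. -/

section Increments

variable {E : Type*} [NormedAddCommGroup E] [InnerProductSpace ℝ E] [FiniteDimensional ℝ E]

theorem inner_gradient_eq (q : E → ℝ) (x w : E) : inner ℝ (gradient q x) w = fderiv ℝ q x w := by
  rw [gradient, InnerProductSpace.toDual_symm_apply]

variable [MeasurableSpace E] [BorelSpace E]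

theorem measurable_gradient (q : E → ℝ) : Measurable (gradient q) := by
  unfold gradient
  exact (InnerProductSpace.toDual ℝ E).symm.continuous.measurable.comp (measurable_fderiv ℝ q)

/-- Triangle inequality along `m` equal steps, each with the same cost by translation invariance. -/
theorem lintegral_increment_le_mul (q : E → ℝ) (hq : Continuous q) (w : E) (m : ℕ) :
    ∫⁻ x, ‖q (x + (m : ℝ) • w) - q x‖ₑ ∂(volume : Measure E) ≤
      m * ∫⁻ x, ‖q (x + w) - q x‖ₑ ∂(volume : Measure E) := by
  induction m with
  | zero => simp
  | succ m ih =>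
    calc ∫⁻ x, ‖q (x + ((m + 1 : ℕ) : ℝ) • w) - q x‖ₑ ∂(volume : Measure E)
        ≤ ∫⁻ x, (‖q (x + (m : ℝ) • w) - q x‖ₑ +
            ‖q (x + (m : ℝ) • w + w) - q (x + (m : ℝ) • w)‖ₑ) ∂(volume : Measure E) := by
          refine lintegral_mono fun x => ?_
          have e : q (x + ((m + 1 : ℕ) : ℝ) • w) - q x = (q (x + (m : ℝ) • w) - q x) +
              (q (x + (m : ℝ) • w + w) - q (x + (m : ℝ) • w)) := by
            push_cast
            rw [add_smul, one_smul, ← add_assoc]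
            ring
          rw [e]
          exact enorm_add_le _ _
      _ = ∫⁻ x, ‖q (x + (m : ℝ) • w) - q x‖ₑ ∂(volume : Measure E) +
          ∫⁻ x, ‖q (x + w) - q x‖ₑ ∂(volume : Measure E) := by
          rw [lintegral_add_left (by fun_prop),
            lintegral_add_right_eq_self (fun x => ‖q (x + w) - q x‖ₑ)]
      _ ≤ _ := by
          push_cast
          rw [add_mul, one_mul]
          gcongr

/-- The `L¹` norm of the increments of a Lipschitz function is controlled by its gradient. -/
theorem lintegral_increment_le (q : E → ℝ) {C : NNReal} (hq : LipschitzWith C q)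
    (hc : HasCompactSupport q) (w : E) :
    ∫⁻ x, ‖q (x + w) - q x‖ₑ ∂(volume : Measure E) ≤
      ∫⁻ x, ‖(inner ℝ (gradient q x) w : ℝ)‖ₑ ∂(volume : Measure E) := by
  -- Difference quotients with step `1 / (m + 1)`. By subdivision each has `L¹` norm at least the
  -- left side, and they converge a.e. to the directional derivative by Rademacher's theorem.
  let F : ℕ → E → ℝ≥0∞ := fun m x =>
    ‖(1 / ((m : ℝ) + 1))⁻¹ • (q (x + (1 / ((m : ℝ) + 1)) • w) - q x)‖ₑ
  have hF : ∀ m, ∫⁻ x, ‖q (x + w) - q x‖ₑ ∂(volume : Measure E) ≤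
      ∫⁻ x, F m x ∂(volume : Measure E) := by
    intro m
    have h := lintegral_increment_le_mul q hq.continuous ((1 / ((m : ℝ) + 1)) • w) (m + 1)
    have hm : ((m : ℝ) + 1) ≠ 0 := by positivity
    rw [smul_smul, Nat.cast_add, Nat.cast_one, mul_one_div_cancel hm, one_smul] at h
    refine h.trans (le_of_eq ?_)
    have e : (((m + 1 : ℕ)) : ℝ≥0∞) = ‖(1 / ((m : ℝ) + 1))⁻¹‖ₑ := by
      rw [one_div, inv_inv, Real.enorm_of_nonneg (by positivity), ← Nat.cast_succ,
        ENNReal.ofReal_natCast]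
    simp only [F, enorm_smul]
    rw [lintegral_const_mul' _ _ enorm_ne_top, ← e, Nat.cast_add, Nat.cast_one]
  -- A compact set outside which all the quotients vanish, the steps being at most `1`; it carries
  -- the dominating function.
  let T : Set E := Metric.cthickening ‖w‖ (tsupport q)
  have hT : IsCompact T := hc.isCompact.cthickening
  have lim : Tendsto (fun m => ∫⁻ x, F m x ∂(volume : Measure E)) atTop
      (𝓝 (∫⁻ x, ‖(inner ℝ (gradient q x) w : ℝ)‖ₑ ∂(volume : Measure E))) := by
    refine tendsto_lintegral_of_dominated_convergence
      (T.indicator fun _ => ENNReal.ofReal (C * ‖w‖)) ?_ ?_ ?_ ?_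
    · intro m
      have := hq.continuous
      fun_prop
    · intro m
      refine Eventually.of_forall fun x => ?_
      have hm : (0 : ℝ) < 1 / ((m : ℝ) + 1) := by positivity
      have hm1 : 1 / ((m : ℝ) + 1) ≤ 1 := by
        rw [div_le_one (by positivity)]; linarith [(Nat.cast_nonneg m : (0 : ℝ) ≤ m)]
      by_cases hx : x ∈ T
      · simp only [F, indicator_of_mem hx]
        rw [← ofReal_norm]
        refine ENNReal.ofReal_le_ofReal ?_
        rw [norm_smul, norm_inv, Real.norm_of_nonneg hm.le, inv_mul_le_iff₀ hm]
        have := hq.dist_le_mul (x + (1 / ((m : ℝ) + 1)) • w) x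
        rw [dist_eq_norm, dist_eq_norm, add_sub_cancel_left, norm_smul,
          Real.norm_of_nonneg hm.le] at this
        linarith
      · have h1 : q x = 0 := by
          by_contra h
          exact hx (Metric.self_subset_cthickening _ (subset_tsupport q h))
        have h2 : q (x + (1 / ((m : ℝ) + 1)) • w) = 0 := by
          by_contra h
          refine hx (Metric.mem_cthickening_of_dist_le x _ _ _ (subset_tsupport q h) ?_)
          rw [dist_eq_norm, sub_add_cancel_left, norm_neg, norm_smul, Real.norm_of_nonneg hm.le]
          exact mul_le_of_le_one_left (norm_nonneg _) hm1
        simp only [F, h1, h2, sub_zero, smul_zero, enorm_zero, zero_le]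
    · refine ne_top_of_le_ne_top ?_ (lintegral_indicator_const_le _ _)
      exact ENNReal.mul_ne_top ENNReal.ofReal_ne_top hT.measure_ne_top
    · filter_upwards [hq.ae_differentiableAt (μ := (volume : Measure E))] with x hx
      have h1 := (hx.hasFDerivAt.hasLineDerivAt w).tendsto_slope_zero_right
      have h2 : Tendsto (fun m : ℕ => 1 / ((m : ℝ) + 1)) atTop (𝓝[>] 0) :=
        tendsto_nhdsWithin_iff.2 ⟨tendsto_one_div_add_atTop_nhds_zero_nat,
          Eventually.of_forall fun m => by simp only [mem_Ioi]; positivity⟩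
      have h3 := (h1.comp h2).enorm
      rw [inner_gradient_eq]
      exact h3
  exact ge_of_tendsto' lim hF

end Increments

/-! ### Lipschitz majorants of convex bodies. -/

section Gauge

variable {n : ℕ}

local notation "E" => EuclideanSpace ℝ (Fin n)

theorem nonempty_interior_of_convex {K : Set E} (hK : Convex ℝ K) (h0 : volume K ≠ 0) :
    (interior K).Nonempty := by
  by_contra h
  rw [not_nonempty_iff_eq_empty] at h
  apply h0
  refine measure_mono_null ?_ (hK.addHaar_frontier volume)
  intro x hx
  rw [frontier, h, sdiff_empty]
  exact subset_closure hx

/-- A ball of radius `ρ` and a far point `y` of `K` span a cone in `K`. The half of it near the ball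
contains `N` disjoint balls of radius `ρ / 2`, too many for the volume of `K`. -/
theorem isBounded_of_convex {K : Set E} (hK : Convex ℝ K) (h0 : volume K ≠ 0)
    (hi : volume K ≠ ∞) : Bornology.IsBounded K := by
  obtain ⟨x₀, hx₀⟩ := nonempty_interior_of_convex hK h0
  obtain ⟨ρ, hρ, hb⟩ := Metric.mem_nhds_iff.1 (mem_interior_iff_mem_nhds.1 hx₀)
  set v := volume (Metric.ball (0 : E) (ρ / 2)) with hv
  have hv0 : v ≠ 0 := (Metric.measure_ball_pos _ _ (by positivity)).ne'
  obtain ⟨N, hN⟩ : ∃ N : ℕ, volume K < N * v := by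
    have hdiv : volume K / v ≠ ∞ := ENNReal.div_ne_top hi hv0
    obtain ⟨N, hN⟩ := ENNReal.exists_nat_gt hdiv
    refine ⟨N, ?_⟩
    rwa [ENNReal.div_lt_iff (Or.inl hv0) (Or.inl measure_ball_lt_top.ne)] at hN
  refine (Metric.isBounded_iff_subset_ball x₀).2 ⟨2 * N * ρ + 1, fun y hy => ?_⟩
  by_contra hfar
  rw [Metric.mem_ball, not_lt, dist_eq_norm] at hfar
  have hN0 : 0 < N := by
    rcases Nat.eq_zero_or_pos N with rfl | h
    · simp at hN
    · exact h
  have hN' : (0 : ℝ) < N := by exact_mod_cast hN0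
  let t : ℕ → ℝ := fun k => k / (2 * N)
  let z : ℕ → E := fun k => x₀ + t k • (y - x₀)
  have hdist : ∀ i j : ℕ, i < j → ρ ≤ dist (z i) (z j) := by
    intro i j hij
    have e : z j - z i = (t j - t i) • (y - x₀) := by
      simp only [z]; rw [sub_smul]; abel
    have ht : 1 / (2 * N) ≤ t j - t i := by
      simp only [t]
      rw [← sub_div]
      gcongr
      have : (i : ℝ) + 1 ≤ j := by exact_mod_cast hij
      linarith
    rw [dist_comm, dist_eq_norm, e, norm_smul]
    have h1 : 1 / (2 * (N : ℝ)) ≤ ‖t j - t i‖ := ht.trans (le_abs_self _)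
    calc ρ = 1 / (2 * N) * (2 * N * ρ) := by field_simp
      _ ≤ ‖t j - t i‖ * ‖y - x₀‖ := by
        gcongr
        linarith
  have hdisj : Pairwise (Function.onFun Disjoint fun k => Metric.ball (z k) (ρ / 2)) := by
    intro i j hij
    refine Metric.ball_disjoint_ball ?_
    rcases lt_or_gt_of_ne hij with h | h
    · linarith [hdist i j h]
    · rw [dist_comm]; linarith [hdist j i h]
  have hsub : ∀ k ∈ Finset.range N, Metric.ball (z k) (ρ / 2) ⊆ K := by
    intro k hk p hp
    have hkN : (k : ℝ) < N := by exact_mod_cast Finset.mem_range.1 hk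
    have ht0 : 0 ≤ t k := by positivity
    have ht : t k ≤ 1 / 2 := by
      simp only [t]; rw [div_le_div_iff₀ (by positivity) (by norm_num)]; linarith
    have h1t : (0 : ℝ) < 1 - t k := by linarith
    have hx : x₀ + (1 - t k)⁻¹ • (p - z k) ∈ K := by
      apply hb
      rw [Metric.mem_ball, dist_eq_norm, add_sub_cancel_left, norm_smul, norm_inv,
        Real.norm_of_nonneg h1t.le, inv_mul_lt_iff₀ h1t]
      rw [Metric.mem_ball, dist_eq_norm] at hp
      nlinarith
    have := hK hx hy h1t.le ht0 (by ring)
    convert this using 1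
    rw [smul_add, smul_smul, mul_inv_cancel₀ h1t.ne', one_smul]
    simp only [z]
    rw [sub_smul, one_smul, smul_sub]
    abel
  have := measure_mono (μ := volume) (iUnion₂_subset hsub)
  rw [measure_biUnion_finset (fun i _ j _ h => hdisj h) (fun _ _ => measurableSet_ball)] at this
  simp only [Measure.addHaar_ball_center] at this
  rw [Finset.sum_const, Finset.card_range, nsmul_eq_mul] at this
  exact absurd hN (not_lt.2 this)

/-- The piecewise linear function equal to `1` up to `1` and to `0` from `1 + 1 / n` on. -/
noncomputable def cutoff (n : ℕ) (p : ℝ) : ℝ := min 1 (max 0 (1 + n * (1 - p)))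

/-- Monotonicity and the Lipschitz constant `n` in a single one-sided statement, suited to gauges
that are not symmetric. -/
theorem cutoff_sub_le {n : ℕ} {p p' s : ℝ} (h : p' ≤ p + s) (hs : 0 ≤ s) :
    cutoff n p - n * s ≤ cutoff n p' := by
  have hn : (0 : ℝ) ≤ n := Nat.cast_nonneg n
  have h1 : (n : ℝ) * (1 - p) - n * s ≤ n * (1 - p') := by nlinarith
  have h2 : 0 ≤ (n : ℝ) * s := by positivity
  simp only [cutoff]
  refine le_min ?_ ?_
  · linarith [min_le_left (1 : ℝ) (max 0 (1 + n * (1 - p)))]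
  · refine (sub_le_sub_right (min_le_right _ _) _).trans ?_
    rw [sub_le_iff_le_add]
    refine max_le ?_ ?_
    · linarith [le_max_left (0 : ℝ) (1 + n * (1 - p'))]
    · linarith [le_max_right (0 : ℝ) (1 + n * (1 - p'))]

/-- A compactly supported Lipschitz majorant of the indicator of a convex body whose gradient
has controlled anisotropic `L¹` norms. -/
theorem exists_lipschitz_majorant (hn : 0 < n) {K : Set E} (hK : Convex ℝ K) (h0 : volume K ≠ 0)
    (hi : volume K ≠ ∞) :
    ∃ q : E → ℝ, (∃ C, LipschitzWith C q) ∧ HasCompactSupport q ∧ (∀ x, 0 ≤ q x) ∧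
      (∀ x ∈ K, 1 ≤ q x) ∧ ∀ (A : E →L[ℝ] E) (c : E), (∀ u, ‖u‖ ≤ 1 → c + A u ∈ K) →
        ∫⁻ x, ‖ContinuousLinearMap.adjoint A (gradient q x)‖ₑ ≤ 3 * n * volume K := by
  obtain ⟨c₀, hc₀⟩ := nonempty_interior_of_convex hK h0
  have hn' : (0 : ℝ) < n := by exact_mod_cast hn
  set K' : Set E := (fun x => x + c₀) ⁻¹' K with hK'
  have hK'c : Convex ℝ K' := hK.translate_preimage_left c₀
  have hK'0 : K' ∈ 𝓝 0 := by
    have : ContinuousAt (fun x : E => x + c₀) 0 := by fun_prop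
    apply this
    simp only [zero_add]
    exact mem_interior_iff_mem_nhds.1 hc₀
  have habs : Absorbent ℝ K' := absorbent_nhds_zero hK'0
  -- The fall from `1` to `0` takes place while the body is dilated by `1 + 1 / n`: slope `n`, yet
  -- the volume grows at most by the factor `e`.
  set q : E → ℝ := fun x => cutoff n (gauge K' (x - c₀)) with hq
  obtain ⟨C, hC⟩ := hK'c.lipschitz_gauge hK'0
  have hstep : ∀ x w : E, w ∈ K' → ∀ s : ℝ, 0 ≤ s → q x - n * s ≤ q (x + s • w) := by
    intro x w hw s hs
    refine cutoff_sub_le ?_ hs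
    have e : x + s • w - c₀ = (x - c₀) + s • w := by abel
    rw [e]
    refine (gauge_add_le hK'c habs _ _).trans ?_
    rw [gauge_smul_of_nonneg hs, smul_eq_mul]
    have := gauge_le_one_of_mem hw
    nlinarith
  have hlip : LipschitzWith (n * C) q := by
    refine LipschitzWith.of_le_add_mul _ fun x y => ?_
    have hd : gauge K' (y - c₀) ≤ gauge K' (x - c₀) + C * dist x y := by
      have := hC.dist_le_mul (y - c₀) (x - c₀)
      rw [Real.dist_eq, dist_sub_right, dist_comm y x] at this
      linarith [le_abs_self (gauge K' (y - c₀) - gauge K' (x - c₀))]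
    have := cutoff_sub_le (n := n) hd (by positivity)
    push_cast
    simp only [hq]
    linarith
  have hq0 : ∀ x, 0 ≤ q x := fun x => le_min zero_le_one (le_max_left _ _)
  have hqK : ∀ x ∈ K, 1 ≤ q x := by
    intro x hx
    have h1 : gauge K' (x - c₀) ≤ 1 := gauge_le_one_of_mem (by simpa [hK'] using hx)
    refine le_min le_rfl ((?_ : (1 : ℝ) ≤ _).trans (le_max_right _ _))
    nlinarith
  set S : Set E := {x | q x ≠ 0} with hS
  have hSo : IsOpen S := isOpen_ne_fun hlip.continuous continuous_const
  have hKbd : Bornology.IsBounded K' := by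
    have := isBounded_of_convex hK h0 hi
    have h2 := this.vadd (-c₀)
    refine h2.subset fun x hx => ⟨x + c₀, hx, ?_⟩
    simp
  have hSsub : S ⊆ (fun x => x - c₀) ⁻¹' ((1 + 1 / n : ℝ) • K') := by
    intro x hx
    have hlt : gauge K' (x - c₀) < 1 + 1 / n := by
      by_contra hge
      apply hx
      have : (1 : ℝ) + n * (1 - gauge K' (x - c₀)) ≤ 0 := by
        have h1 : (n : ℝ) * (1 + 1 / n) ≤ n * gauge K' (x - c₀) := by
          gcongr; exact not_lt.1 hge
        rw [mul_add, mul_one_div_cancel hn'.ne'] at h1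
        linarith
      simp only [hq, cutoff, max_eq_left this]
      simp
    obtain ⟨b, hb0, hb1, hb⟩ := exists_lt_of_gauge_lt habs hlt
    obtain ⟨k, hk, hkx⟩ := hb
    have h1n : (0 : ℝ) < 1 + 1 / n := by positivity
    refine ⟨(b / (1 + 1 / n)) • k, ?_, ?_⟩
    · have h0K : (0 : E) ∈ K' := mem_of_mem_nhds hK'0
      have := hK'c.smul_mem_of_zero_mem h0K hk
        (t := b / (1 + 1 / n)) ⟨by positivity, (div_le_one h1n).2 hb1.le⟩
      exact this
    · simp only [smul_smul]
      rw [mul_div_cancel₀ _ h1n.ne']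
      exact hkx
  have hSvol : volume S ≤ 3 * volume K := by
    refine (measure_mono hSsub).trans ?_
    have e1 : volume ((fun x => x - c₀) ⁻¹' ((1 + 1 / n : ℝ) • K')) =
        volume ((1 + 1 / n : ℝ) • K') := by
      simp only [sub_eq_add_neg]
      exact measure_preimage_add_right volume (-c₀) _
    have e2 : volume K' = volume K := measure_preimage_add_right volume c₀ K
    rw [e1, Measure.addHaar_smul, e2, finrank_euclideanSpace_fin]
    gcongr
    have h3 : |(1 + 1 / n : ℝ) ^ n| ≤ 3 := by
      rw [abs_of_nonneg (by positivity)]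
      have := Real.add_one_le_exp (1 / (n : ℝ))
      calc (1 + 1 / n : ℝ) ^ n ≤ (Real.exp (1 / n)) ^ n := by gcongr; linarith
        _ = Real.exp 1 := by rw [← Real.exp_nat_mul, mul_one_div_cancel hn'.ne']
        _ ≤ 3 := by linarith [Real.exp_one_lt_d9]
    calc ENNReal.ofReal |(1 + 1 / n : ℝ) ^ n| ≤ ENNReal.ofReal 3 := ENNReal.ofReal_le_ofReal h3
      _ = 3 := by norm_num
  have hSbd : Bornology.IsBounded S := by
    have h1 : Bornology.IsBounded ((1 + 1 / n : ℝ) • K') := hKbd.smul₀ _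
    refine (h1.vadd c₀).subset fun x hx => ⟨x - c₀, hSsub hx, ?_⟩
    simp
  have hcs : HasCompactSupport q :=
    Metric.isCompact_of_isClosed_isBounded (isClosed_tsupport q) hSbd.closure
  refine ⟨q, ⟨_, hlip⟩, hcs, hq0, hqK, fun A c hA => ?_⟩
  have hgrad0 : ∀ x, x ∉ S → gradient q x = 0 := by
    intro x hx
    have hx0 : q x = 0 := by simpa [hS] using hx
    have hmin : IsLocalMin q x := Eventually.of_forall fun y => by rw [hx0]; exact hq0 y
    rw [gradient, hmin.fderiv_eq_zero, map_zero]
  -- On `S`, directional derivatives along vectors of `K'` are at least `-n`. Test with the point of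
  -- the ellipsoid where the gradient is most negative; its centre contributes the linear term.
  have hpt : ∀ᵐ x, ‖ContinuousLinearMap.adjoint A (gradient q x)‖ ≤
      S.indicator (fun _ => (n : ℝ)) x + inner ℝ (gradient q x) (c - c₀) := by
    filter_upwards [hlip.ae_differentiableAt (μ := (volume : Measure E))] with x hx
    by_cases hxS : x ∈ S
    · rw [indicator_of_mem hxS]
      set V := gradient q x with hV
      set a := ContinuousLinearMap.adjoint A V with ha
      have hder : ∀ w ∈ K', -(n : ℝ) ≤ inner ℝ V w := by
        intro w hw
        rw [hV, inner_gradient_eq]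
        have h1 := (hx.hasFDerivAt.hasLineDerivAt w).tendsto_slope_zero_right
        refine ge_of_tendsto h1 ?_
        filter_upwards [self_mem_nhdsWithin] with s hs
        have hs' : (0 : ℝ) < s := hs
        have := hstep x w hw s hs'.le
        rw [smul_eq_mul, le_inv_mul_iff₀ hs']
        linarith
      have hu : ‖-(‖a‖⁻¹ • a)‖ ≤ 1 := by
        rw [norm_neg, norm_smul, norm_inv, norm_norm]
        exact inv_mul_le_one
      have hmem := hA _ hu
      have h2 := hder (c + A (-(‖a‖⁻¹ • a)) - c₀) (by simpa [hK'] using hmem)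
      have h3 : inner ℝ V (A (-(‖a‖⁻¹ • a))) = -‖a‖ := by
        rw [← ContinuousLinearMap.adjoint_inner_left, ← ha, inner_neg_right, inner_smul_right,
          real_inner_self_eq_norm_sq]
        rcases eq_or_ne ‖a‖ 0 with h | h
        · rw [h]; simp
        · field_simp
      have e : c + A (-(‖a‖⁻¹ • a)) - c₀ = (c - c₀) + A (-(‖a‖⁻¹ • a)) := by abel
      rw [e, inner_add_right, h3] at h2
      linarith
    · rw [hgrad0 x hxS]; simp [hxS]
  have hbound : ∀ x, ‖gradient q x‖ ≤ (n * C : NNReal) := fun x => by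
    rw [gradient, LinearIsometryEquiv.norm_map]
    exact norm_fderiv_le_of_lipschitz ℝ hlip
  have hSfin : volume S ≠ ∞ := ne_top_of_le_ne_top (ENNReal.mul_ne_top (by simp) hi) hSvol
  have hint : Integrable (fun x => (inner ℝ (gradient q x) (c - c₀) : ℝ)) := by
    have hon : IntegrableOn (fun x => (inner ℝ (gradient q x) (c - c₀) : ℝ)) S := by
      refine Measure.integrableOn_of_bounded (M := (n * C : NNReal) * ‖c - c₀‖) hSfin ?_ ?_
      · exact ((measurable_gradient q).inner measurable_const).aestronglyMeasurable
      · refine Eventually.of_forall fun x => (norm_inner_le_norm _ _).trans ?_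
        gcongr
        exact hbound x
    refine (integrableOn_iff_integrable_of_support_subset ?_).1 hon
    intro x hx
    by_contra h
    apply hx
    simp [hgrad0 x h]
  -- A derivative of a compactly supported Lipschitz function integrates to zero, so the position of
  -- the ellipsoid does not matter.
  have hzero : ∫ x, (inner ℝ (gradient q x) (c - c₀) : ℝ) = 0 := by
    have h1 := LipschitzWith.integral_lineDeriv_mul_eq (μ := (volume : Measure E))
      (LipschitzWith.const (1 : ℝ)) hlip hcs (-(c - c₀))
    have h2 : ∀ x v, lineDeriv ℝ (fun _ : E => (1 : ℝ)) x v = 0 := by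
      intro x v; simp [lineDeriv]
    simp only [h2, zero_mul, integral_zero, neg_neg, mul_one] at h1
    rw [h1]
    refine integral_congr_ae ?_
    filter_upwards [hlip.ae_differentiableAt (μ := (volume : Measure E))] with x hx
    rw [inner_gradient_eq, hx.lineDeriv_eq_fderiv]
  have hint2 : Integrable (S.indicator fun _ => (n : ℝ)) :=
    (integrable_indicator_iff hSo.measurableSet).2 (integrableOn_const hSfin)
  have hnn : 0 ≤ᵐ[volume] fun x : E => S.indicator (fun _ => (n : ℝ)) x +
      inner ℝ (gradient q x) (c - c₀) := by
    filter_upwards [hpt] with x hx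
    exact (norm_nonneg _).trans hx
  calc ∫⁻ x, ‖ContinuousLinearMap.adjoint A (gradient q x)‖ₑ
      ≤ ∫⁻ x, ENNReal.ofReal (S.indicator (fun _ => (n : ℝ)) x +
          inner ℝ (gradient q x) (c - c₀)) := by
        refine lintegral_mono_ae ?_
        filter_upwards [hpt] with x hx
        rw [← ofReal_norm]
        exact ENNReal.ofReal_le_ofReal hx
    _ = ENNReal.ofReal (∫ x, (S.indicator (fun _ => (n : ℝ)) x +
          inner ℝ (gradient q x) (c - c₀))) :=
        (ofReal_integral_eq_lintegral_ofReal (hint2.add hint) hnn).symm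
    _ = ENNReal.ofReal (volume.real S * n) := by
        rw [integral_add hint2 hint, hzero, add_zero, integral_indicator_const _ hSo.measurableSet,
          smul_eq_mul]
    _ = volume S * n := by
        rw [ENNReal.ofReal_mul measureReal_nonneg, ofReal_measureReal hSfin,
          ENNReal.ofReal_natCast]
    _ ≤ 3 * volume K * n := by gcongr
    _ = _ := by ring

end Gauge

/-! ### Large ellipsoids inside convex bodies. -/

section Ellipsoid

variable {n : ℕ}

local notation "E" => EuclideanSpace ℝ (Fin n)

/-- Compare with the Gaussian `exp (-π ‖x‖² / 36)`: its integral is `6 ^ n`, and on the ball it is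
at least `e⁻ⁿ ≥ 3⁻ⁿ` because `π ≤ 4`. -/
theorem volume_closedBall_sqrt_le :
    volume (Metric.closedBall (0 : E) (3 * √n)) ≤ ENNReal.ofReal (18 ^ n) := by
  have hb : 0 < Real.pi / 36 := by positivity
  have hval : ∫ x : E, Real.exp (-(Real.pi / 36) * ‖x‖ ^ 2) = 6 ^ n := by
    rw [GaussianFourier.integral_rexp_neg_mul_sq_norm hb, finrank_euclideanSpace_fin,
      div_div_cancel₀ Real.pi_pos.ne', show (36 : ℝ) = 6 ^ (2 : ℝ) by norm_num,
      ← Real.rpow_mul (by norm_num), mul_div_cancel₀ _ (by norm_num), Real.rpow_natCast]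
  have hint : Integrable fun x : E => Real.exp (-(Real.pi / 36) * ‖x‖ ^ 2) := by
    by_contra h
    rw [integral_undef h] at hval
    exact absurd hval (by positivity)
  have hpt : ∀ x ∈ Metric.closedBall (0 : E) (3 * √n),
      ((3 : ℝ) ^ n)⁻¹ ≤ Real.exp (-(Real.pi / 36) * ‖x‖ ^ 2) := by
    intro x hx
    rw [mem_closedBall_zero_iff] at hx
    have h1 : ‖x‖ ^ 2 ≤ 9 * (n : ℝ) := by
      calc ‖x‖ ^ 2 ≤ (3 * √(n : ℝ)) ^ 2 := by gcongr
        _ = 9 * (n : ℝ) := by rw [mul_pow, Real.sq_sqrt (Nat.cast_nonneg n)]; norm_num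
    have h2 : -(n : ℝ) ≤ -(Real.pi / 36) * ‖x‖ ^ 2 := by
      have := Real.pi_le_four
      have hn : (0 : ℝ) ≤ n := Nat.cast_nonneg n
      nlinarith [sq_nonneg ‖x‖, Real.pi_pos]
    refine le_trans ?_ (Real.exp_le_exp.2 h2)
    rw [Real.exp_neg]
    refine inv_anti₀ (Real.exp_pos _) ?_
    rw [← mul_one (n : ℝ), Real.exp_nat_mul]
    gcongr
    linarith [Real.exp_one_lt_d9]
  have hm : MeasurableSet (Metric.closedBall (0 : E) (3 * √n)) := measurableSet_closedBall
  have hfin : volume (Metric.closedBall (0 : E) (3 * √n)) ≠ ∞ := measure_closedBall_lt_top.ne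
  have h := setIntegral_mono_on (integrableOn_const hfin) hint.integrableOn hm hpt
  rw [setIntegral_const, smul_eq_mul] at h
  have h2 := h.trans (setIntegral_le_integral hint (Eventually.of_forall fun x => (Real.exp_pos _).le))
  rw [hval, ← div_eq_mul_inv, div_le_iff₀ (by positivity), ← mul_pow] at h2
  rw [← ofReal_measureReal hfin]
  refine ENNReal.ofReal_le_ofReal (h2.trans (by norm_num))

/-- Some point reflection preserves a proportion `2⁻ⁿ` of an open convex set. -/
theorem exists_center {K : Set E} (hK : Convex ℝ K) (hKo : IsOpen K) (h0 : volume K ≠ 0)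
    (hi : volume K ≠ ∞) :
    ∃ c ∈ K, volume K ≤ 2 ^ n * volume {x | c + x ∈ K ∧ c - x ∈ K} := by
  have hmeas : MeasurableSet {p : E × E | p.1 + p.2 ∈ K ∧ p.1 - p.2 ∈ K} :=
    ((hKo.preimage (by fun_prop : Continuous fun p : E × E => p.1 + p.2)).inter
      (hKo.preimage (by fun_prop : Continuous fun p : E × E => p.1 - p.2))).measurableSet
  let g : E → ℝ≥0∞ := fun c => volume {x | c + x ∈ K ∧ c - x ∈ K}
  have hgm : Measurable g := measurable_measure_prodMk_left hmeas
  have hg0 : ∀ c, c ∉ K → g c = 0 := by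
    intro c hc
    have : {x | c + x ∈ K ∧ c - x ∈ K} = ∅ := by
      refine eq_empty_of_forall_notMem fun x hx => hc ?_
      have := hK hx.1 hx.2 (a := 1 / 2) (b := 1 / 2) (by norm_num) (by norm_num) (by norm_num)
      convert this using 1
      module
    simp only [g, this, measure_empty]
  -- `g c` is the convolution of the indicator of `K` with itself at `2 c`. As `g` vanishes off `K`,
  -- some `c ∈ K` attains its average over `K`.
  have htot : 2 ^ n * ∫⁻ c, g c = volume K * volume K := by
    have hKm : Measurable (K.indicator (1 : E → ℝ≥0∞)) :=
      measurable_one.indicator hKo.measurableSet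
    have e1 : ∀ c, g c = ∫⁻ y, K.indicator 1 y * K.indicator 1 ((2 : ℝ) • c - y) := by
      intro c
      have hm : MeasurableSet {x | c + x ∈ K ∧ c - x ∈ K} := hmeas.preimage measurable_prodMk_left
      rw [← lintegral_add_left_eq_self _ c]
      simp only [g]
      rw [← lintegral_indicator_one hm]
      refine lintegral_congr fun x => ?_
      have e : (2 : ℝ) • c - (c + x) = c - x := by rw [two_smul]; abel
      rw [e]
      by_cases h1 : c + x ∈ K <;> by_cases h2 : c - x ∈ K <;> simp [indicator, h1, h2]
    have e2 : ∀ y, ∫⁻ c, K.indicator (1 : E → ℝ≥0∞) ((2 : ℝ) • c - y) =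
        (2 ^ n)⁻¹ * volume K := by
      intro y
      have e3 : (fun c : E => K.indicator (1 : E → ℝ≥0∞) ((2 : ℝ) • c - y)) =
          ((fun c : E => (2 : ℝ) • c) ⁻¹' ((fun x => x + -y) ⁻¹' K)).indicator 1 := by
        ext c
        by_cases hc : (2 : ℝ) • c - y ∈ K
        · have hc' : c ∈ (fun c : E => (2 : ℝ) • c) ⁻¹' ((fun x => x + -y) ⁻¹' K) := by
            rwa [mem_preimage, mem_preimage, ← sub_eq_add_neg]
          rw [indicator_of_mem hc, indicator_of_mem hc', Pi.one_apply, Pi.one_apply]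
        · have hc' : c ∉ (fun c : E => (2 : ℝ) • c) ⁻¹' ((fun x => x + -y) ⁻¹' K) := by
            rwa [mem_preimage, mem_preimage, ← sub_eq_add_neg]
          rw [indicator_of_notMem hc, indicator_of_notMem hc']
      have hm : MeasurableSet ((fun x => x + -y) ⁻¹' K) :=
        hKo.measurableSet.preimage (by fun_prop)
      rw [e3, lintegral_indicator_one (hm.preimage (by fun_prop)),
        Measure.addHaar_preimage_smul volume (by norm_num), measure_preimage_add_right,
        finrank_euclideanSpace_fin, abs_of_nonneg (by positivity),
        ENNReal.ofReal_inv_of_pos (by positivity), ENNReal.ofReal_pow (by norm_num)]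
      norm_num
    have e4 : ∫⁻ c, g c = volume K * ((2 ^ n)⁻¹ * volume K) := by
      simp only [e1]
      rw [lintegral_lintegral_swap]
      · have : ∀ y, ∫⁻ c, K.indicator (1 : E → ℝ≥0∞) y * K.indicator 1 ((2 : ℝ) • c - y) =
            K.indicator 1 y * ((2 ^ n)⁻¹ * volume K) := by
          intro y
          have hm : Measurable fun c : E => K.indicator (1 : E → ℝ≥0∞) ((2 : ℝ) • c - y) :=
            hKm.comp (by fun_prop : Measurable fun c : E => (2 : ℝ) • c - y)
          rw [lintegral_const_mul _ hm, e2]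
        simp only [this]
        rw [lintegral_mul_const _ hKm, lintegral_indicator_one hKo.measurableSet]
      · exact ((hKm.comp measurable_snd).mul
          (hKm.comp (by fun_prop : Measurable fun p : E × E => (2 : ℝ) • p.1 - p.2))).aemeasurable
    rw [e4]
    calc 2 ^ n * (volume K * ((2 ^ n)⁻¹ * volume K))
        = (2 ^ n * (2 ^ n)⁻¹) * (volume K * volume K) := by ring
      _ = _ := by rw [ENNReal.mul_inv_cancel (by simp) (by simp), one_mul]
  have hle : ∫⁻ c in K, g c = ∫⁻ c, g c := by
    rw [← lintegral_indicator hKo.measurableSet]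
    congr 1
    ext c
    by_cases hc : c ∈ K
    · simp [hc]
    · simp [hc, hg0 c hc]
  have hgi : ∫⁻ c in K, g c ≠ ∞ := by
    rw [hle]
    intro htop
    rw [htop, ENNReal.mul_top (by simp)] at htot
    exact ENNReal.mul_ne_top hi hi htot.symm
  obtain ⟨c, hc, hcg⟩ := exists_setLAverage_le h0 hKo.measurableSet.nullMeasurableSet hgi
  refine ⟨c, hc, ?_⟩
  rw [setLAverage_eq, hle] at hcg
  calc volume K = (volume K * volume K) / volume K := by
        rw [ENNReal.mul_div_cancel_right h0 hi]
    _ = 2 ^ n * ((∫⁻ c, g c) / volume K) := by rw [← htot, mul_div_assoc]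
    _ ≤ _ := by gcongr

/-- Stretching the unit ball towards a far point of a convex set gains volume. -/
theorem exists_det_gain (hn : 0 < n) (y : E) (hy : ‖y‖ = 3 * √n) :
    ∃ D : E →L[ℝ] E, 3 / 2 ≤ D.det ∧ ∀ u, ‖u‖ ≤ 1 → ∃ l : ℝ, 0 ≤ l ∧ l ≤ 1 ∧ ∃ z w : E,
      (z = y ∨ z = -y) ∧ ‖w‖ ≤ 1 ∧ D u = l • z + (1 - l) • w := by
  have hn' : (0 : ℝ) < n := by exact_mod_cast hn
  have hn1 : (1 : ℝ) ≤ n := by exact_mod_cast hn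
  set R := 3 * √(n : ℝ) with hR
  have hR0 : 0 < R := by positivity
  have hR2 : R ^ 2 = 9 * n := by rw [hR, mul_pow, Real.sq_sqrt hn'.le]; norm_num
  -- The map stretches by `a = k R` along `y` and shrinks by `b = √(1 - k²)` across. With `k² = 1 /
  -- (2n)` and `R² = 9n`, `a² = 9 / 2` and `b ^ (2 (n - 1)) ≥ 1 / 2`, so the determinant is at least
  -- `3 / 2`.
  set k := √(1 / (2 * n) : ℝ) with hk
  have hk0 : 0 < k := by positivity
  have hk2 : k ^ 2 = 1 / (2 * n) := Real.sq_sqrt (by positivity)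
  have hk2' : k ^ 2 ≤ 1 / 2 := by
    rw [hk2, div_le_div_iff₀ (by positivity) (by norm_num)]; linarith
  have hk1 : k < 1 := by nlinarith
  set b := √(1 - k ^ 2) with hb
  have hb2 : b ^ 2 = 1 - k ^ 2 := Real.sq_sqrt (by linarith)
  have hb0 : 0 < b := Real.sqrt_pos.2 (by linarith)
  set a := k * R with ha
  have ha0 : 0 < a := by positivity
  have ha2 : a ^ 2 = 9 / 2 := by rw [ha, mul_pow, hk2, hR2]; field_simp
  obtain ⟨e, he1, hye⟩ : ∃ e : E, ‖e‖ = 1 ∧ y = R • e := by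
    refine ⟨R⁻¹ • y, ?_, ?_⟩
    · rw [norm_smul, norm_inv, Real.norm_of_nonneg hR0.le, hy, inv_mul_cancel₀ hR0.ne']
    · rw [smul_smul, mul_inv_cancel₀ hR0.ne', one_smul]
  let f : E →ₗ[ℝ] ℝ := (innerSL ℝ e).toLinearMap
  let tr := LinearMap.transvection f (((a - b) / b) • e)
  refine ⟨LinearMap.toContinuousLinearMap (b • tr), ?_, fun u hu => ?_⟩
  · have hdet : (LinearMap.toContinuousLinearMap (b • tr)).det = b ^ n * (a / b) := by
      have h1 : (LinearMap.toContinuousLinearMap (b • tr)).det = LinearMap.det (b • tr) := rfl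
      have h2 : f e = 1 := by
        change inner ℝ e e = 1
        rw [real_inner_self_eq_norm_sq, he1, one_pow]
      rw [h1, LinearMap.det_smul, finrank_euclideanSpace_fin, LinearMap.transvection.det,
        map_smul, h2, smul_eq_mul, mul_one]
      field_simp
      ring
    rw [hdet]
    obtain ⟨m, rfl⟩ : ∃ m, n = m + 1 := ⟨n - 1, by omega⟩
    have h3 : b ^ (m + 1) * (a / b) = a * b ^ m := by
      rw [pow_succ]; field_simp
    rw [h3]
    have h4 : 1 / 2 ≤ (b ^ 2) ^ m := by
      have hB := one_add_mul_le_pow (a := -(k ^ 2)) (by linarith) m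
      rw [hb2, sub_eq_add_neg]
      refine le_trans ?_ hB
      have : (m : ℝ) * k ^ 2 ≤ 1 / 2 := by
        rw [hk2]; push_cast
        rw [mul_one_div, div_le_div_iff₀ (by positivity) (by norm_num)]
        linarith
      linarith
    refine le_of_sq_le_sq ?_ (by positivity)
    rw [mul_pow, ha2, ← pow_mul, mul_comm m 2, pow_mul]
    linarith
  · set t : ℝ := inner ℝ e u with ht
    have hD : (LinearMap.toContinuousLinearMap (b • tr)) u = (a * t) • e + b • (u - t • e) := by
      have : (LinearMap.toContinuousLinearMap (b • tr)) u =
          b • (u + t • (((a - b) / b) • e)) := rfl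
      have e1 : b * t * ((a - b) / b) = a * t - b * t := by field_simp
      rw [this, smul_add, smul_smul, smul_smul, e1]
      module
    have hnu : ‖u - t • e‖ ^ 2 ≤ 1 - t ^ 2 := by
      rw [norm_sub_sq_real, inner_smul_right, real_inner_comm, ← ht, norm_smul, he1, mul_one,
        Real.norm_eq_abs, sq_abs]
      nlinarith [norm_nonneg u]
    have ht1 : |t| ≤ 1 := by
      refine (abs_real_inner_le_norm _ _).trans ?_
      rw [he1, one_mul]; exact hu
    have hl1 : k * |t| < 1 := by nlinarith [abs_nonneg t]
    -- This puts the image of `u` in the hull of `±y` and the ball, with weight `k * |t|` on `±y`.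
    -- It follows from `(1 - k |t|)² - (1 - k²)(1 - t²) = (|t| - k)²`.
    have hbn : ‖b • (u - t • e)‖ ≤ 1 - k * |t| := by
      rw [norm_smul, Real.norm_of_nonneg hb0.le]
      refine le_of_sq_le_sq ?_ (by linarith)
      rw [mul_pow, hb2]
      have h1 : (1 - k ^ 2) * ‖u - t • e‖ ^ 2 ≤ (1 - k ^ 2) * (1 - t ^ 2) := by
        gcongr; linarith
      nlinarith [sq_nonneg (|t| - k), sq_abs t]
    refine ⟨k * |t|, by positivity, hl1.le, if 0 ≤ t then y else -y,
      (1 - k * |t|)⁻¹ • (b • (u - t • e)), ?_, ?_, ?_⟩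
    · split_ifs <;> simp
    · rw [norm_smul, norm_inv, Real.norm_of_nonneg (by linarith),
        inv_mul_le_iff₀ (by linarith), mul_one]
      exact hbn
    · rw [hD, smul_smul (1 - k * |t|), mul_inv_cancel₀ (by linarith), one_smul]
      congr 1
      split_ifs with h
      · rw [abs_of_nonneg h, hye, smul_smul, ha]; congr 1; ring
      · rw [abs_of_neg (not_le.1 h), hye, ← neg_smul, smul_smul, ha]
        congr 1; ring

/-- A symmetric convex body contains an ellipsoid which is large up to an exponential factor. -/
theorem exists_ellipsoid_symm (hn : 0 < n) {L : Set E} (hL : Convex ℝ L) (hLo : IsOpen L)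
    (hsymm : ∀ x ∈ L, -x ∈ L) (h0L : (0 : E) ∈ L) (hi : volume L ≠ ∞) :
    ∃ A : E →L[ℝ] E, (∀ u, ‖u‖ ≤ 1 → A u ∈ L) ∧ volume L ≤ ENNReal.ofReal (18 ^ n * |A.det|) := by
  set S : Set ℝ := {d | ∃ A : E →L[ℝ] E, (∀ u, ‖u‖ ≤ 1 → A u ∈ L) ∧ |A.det| = d} with hS
  set v := volume (Metric.closedBall (0 : E) 1) with hv
  have hv0 : v ≠ 0 := (Metric.measure_closedBall_pos _ _ one_pos).ne'
  have hvi : v ≠ ∞ := measure_closedBall_lt_top.ne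
  have hbdd : BddAbove S := by
    refine ⟨(volume L / v).toReal, ?_⟩
    rintro _ ⟨A, hA, rfl⟩
    have h1 : A '' Metric.closedBall 0 1 ⊆ L := by
      rintro _ ⟨u, hu, rfl⟩
      exact hA u (by simpa using hu)
    have h2 := measure_mono (μ := volume) h1
    rw [Measure.addHaar_image_continuousLinearMap] at h2
    have h3 : ENNReal.ofReal |A.det| ≤ volume L / v :=
      (ENNReal.le_div_iff_mul_le (Or.inl hv0) (Or.inl hvi)).2 h2
    exact (ENNReal.ofReal_le_iff_le_toReal (ENNReal.div_ne_top hi hv0)).1 h3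
  obtain ⟨ρ, hρ, hb⟩ := Metric.mem_nhds_iff.1 (hLo.mem_nhds h0L)
  have hmem : (ρ / 2) ^ n ∈ S := by
    refine ⟨(ρ / 2) • ContinuousLinearMap.id ℝ E, fun u hu => hb ?_, ?_⟩
    · rw [mem_ball_zero_iff]
      simp only [_root_.smul_apply, ContinuousLinearMap.id_apply, norm_smul]
      rw [Real.norm_of_nonneg (by positivity)]
      nlinarith [norm_nonneg u]
    · have : ((ρ / 2) • ContinuousLinearMap.id ℝ E).det =
        LinearMap.det ((ρ / 2) • (LinearMap.id : E →ₗ[ℝ] E)) := rfl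
      rw [this, LinearMap.det_smul, LinearMap.det_id, mul_one, finrank_euclideanSpace_fin,
        abs_of_nonneg (by positivity)]
  have hpos : 0 < sSup S := lt_of_lt_of_le (by positivity) (le_csSup hbdd hmem)
  -- A nearly maximal ellipsoid suffices: within a factor `2 / 3` of the supremum, a gain of `3 / 2`
  -- in determinant is impossible, which excludes points of `L` at distance `3 √n` in ellipsoid
  -- coordinates.
  obtain ⟨_, ⟨A, hA, rfl⟩, hAs⟩ := exists_lt_of_lt_csSup ⟨_, hmem⟩
    (show 2 / 3 * sSup S < sSup S by linarith)
  have hA0 : 0 < |A.det| := lt_trans (by positivity) hAs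
  have hfar : ∀ y, ‖y‖ = 3 * √n → A y ∉ L := by
    intro y hy hAy
    obtain ⟨D, hD, hDu⟩ := exists_det_gain hn y hy
    have hin : |(A ∘L D).det| ∈ S := by
      refine ⟨A ∘L D, fun u hu => ?_, rfl⟩
      obtain ⟨l, hl0, hl1, z, w, hz, hw, e⟩ := hDu u hu
      rw [ContinuousLinearMap.comp_apply, e, map_add, map_smul, map_smul]
      refine hL ?_ (hA w hw) hl0 (by linarith) (by ring)
      rcases hz with rfl | rfl
      · exact hAy
      · rw [map_neg]; exact hsymm _ hAy
    have h1 := le_csSup hbdd hin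
    have h2 : (A ∘L D).det = A.det * D.det := LinearMap.det_comp _ _
    rw [h2, abs_mul, abs_of_pos (lt_of_lt_of_le (by norm_num) hD)] at h1
    nlinarith
  refine ⟨A, hA, ?_⟩
  have hdet0 : LinearMap.det (A : E →ₗ[ℝ] E) ≠ 0 := abs_pos.1 hA0
  let e := (A : E →ₗ[ℝ] E).equivOfDetNeZero hdet0
  have hsub : L ⊆ A '' Metric.closedBall 0 (3 * √n) := by
    intro x hx
    refine ⟨e.symm x, ?_, e.apply_symm_apply x⟩
    rw [mem_closedBall_zero_iff]
    by_contra hlt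
    rw [not_le] at hlt
    have hR : 0 ≤ 3 * √(n : ℝ) := by positivity
    have hy0 : 0 < ‖e.symm x‖ := lt_of_le_of_lt hR hlt
    refine hfar ((3 * √n / ‖e.symm x‖) • e.symm x) ?_ ?_
    · rw [norm_smul, Real.norm_of_nonneg (by positivity), div_mul_cancel₀ _ hy0.ne']
    · rw [map_smul]
      have e1 : A (e.symm x) = x := e.apply_symm_apply x
      rw [e1]
      exact hL.smul_mem_of_zero_mem h0L hx ⟨by positivity, (div_le_one hy0).2 hlt.le⟩
  refine (measure_mono hsub).trans ?_
  rw [Measure.addHaar_image_continuousLinearMap, mul_comm,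
    ENNReal.ofReal_mul (by positivity)]
  gcongr
  exact volume_closedBall_sqrt_le

/-- A convex body contains an ellipsoid which is large up to an exponential factor. -/
theorem exists_ellipsoid (hn : 0 < n) {K : Set E} (hK : Convex ℝ K) (h0 : volume K ≠ 0)
    (hi : volume K ≠ ∞) :
    ∃ (A : E →L[ℝ] E) (c : E), (∀ u, ‖u‖ ≤ 1 → c + A u ∈ K) ∧
      volume K ≤ ENNReal.ofReal (36 ^ n * |A.det|) := by
  have hint : volume (interior K) = volume K :=
    measure_congr (interior_ae_eq_of_null_frontier (hK.addHaar_frontier volume))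
  -- Symmetrizing about a good centre costs `2 ^ n`; with the `18 ^ n` of the symmetric case this
  -- gives `36 ^ n`.
  obtain ⟨c, hc, hcv⟩ := exists_center hK.interior isOpen_interior (hint ▸ h0) (hint ▸ hi)
  set L : Set E := {x | c + x ∈ interior K ∧ c - x ∈ interior K} with hL
  have hLo : IsOpen L := (isOpen_interior.preimage (by fun_prop : Continuous fun x : E => c + x)).inter
    (isOpen_interior.preimage (by fun_prop : Continuous fun x : E => c - x))
  have hLc : Convex ℝ L := by
    intro x hx y hy a b ha hb hab
    constructor
    · have := hK.interior hx.1 hy.1 ha hb hab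
      convert this using 1
      rw [smul_add, smul_add, add_add_add_comm, ← add_smul, hab, one_smul]
    · have := hK.interior hx.2 hy.2 ha hb hab
      convert this using 1
      rw [smul_sub, smul_sub, sub_add_sub_comm, ← add_smul, hab, one_smul]
  have hLi : volume L ≠ ∞ := by
    refine ne_top_of_le_ne_top hi ?_
    calc volume L ≤ volume ((fun x => c + x) ⁻¹' K) :=
          measure_mono fun x hx => interior_subset (s := K) hx.1
      _ = volume K := measure_preimage_add volume c K
  obtain ⟨A, hA, hAv⟩ := exists_ellipsoid_symm hn hLc hLo
    (fun x hx => ⟨by simpa [← sub_eq_add_neg] using hx.2, by simpa using hx.1⟩)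
    (by simpa [hL] using hc) hLi
  refine ⟨A, c, fun u hu => interior_subset (hA u hu).1, ?_⟩
  rw [← hint]
  refine hcv.trans ?_
  calc (2 : ℝ≥0∞) ^ n * volume L ≤ 2 ^ n * ENNReal.ofReal (18 ^ n * |A.det|) := by gcongr
    _ = ENNReal.ofReal (2 ^ n) * ENNReal.ofReal (18 ^ n * |A.det|) := by
        rw [ENNReal.ofReal_pow (by norm_num)]; norm_num
    _ = _ := by
        rw [← ENNReal.ofReal_mul (by positivity), ← mul_assoc, ← mul_pow]; norm_num

end Ellipsoid

/-! ### Minimal position of a vector field and mixed discriminants. -/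

section IsotropicPosition

variable {n : ℕ}

local notation "E" => EuclideanSpace ℝ (Fin n)

theorem det_smul_clm (r : ℝ) (A : E →L[ℝ] E) : (r • A).det = r ^ n * A.det := by
  have h : (r • A).det = LinearMap.det (r • (A : E →ₗ[ℝ] E)) := rfl
  rw [h, LinearMap.det_smul, finrank_euclideanSpace_fin]

theorem abs_apply_mul_le (w : E) (i k : Fin n) : |w i * w k| ≤ ‖w‖ ^ 2 := by
  rw [abs_mul, sq]
  exact mul_le_mul (PiLp.norm_apply_le w i) (PiLp.norm_apply_le w k) (abs_nonneg _) (norm_nonneg _)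

/-- Concavity of the square root at `‖w‖ ^ 2`. The quadratic remainder is proportional to `‖w‖`, so
the expansion can be integrated. -/
theorem norm_add_smul_single_le (w : E) (i k : Fin n) (s : ℝ) :
    ‖w + (s * w k) • EuclideanSpace.single i (1 : ℝ)‖ ≤
      ‖w‖ + s * (w i * w k / ‖w‖) + s ^ 2 / 2 * ‖w‖ := by
  rcases eq_or_ne w 0 with rfl | hw
  · simp
  have hN : 0 < ‖w‖ := norm_pos_iff.2 hw
  have hp := abs_apply_mul_le w i k
  have hk : (w k) ^ 2 ≤ ‖w‖ ^ 2 := by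
    have := abs_apply_mul_le w k k
    rwa [← sq, abs_of_nonneg (sq_nonneg _)] at this
  have hsq : ‖w + (s * w k) • EuclideanSpace.single i (1 : ℝ)‖ ^ 2 =
      ‖w‖ ^ 2 + 2 * s * (w i * w k) + s ^ 2 * (w k) ^ 2 := by
    rw [norm_add_sq_real, inner_smul_right, EuclideanSpace.inner_single_right, norm_smul,
      PiLp.norm_single]
    simp only [norm_one, mul_one, Real.norm_eq_abs, sq_abs, conj_trivial, one_mul]
    ring
  set N := ‖w‖ with hNdef
  set p := w i * w k with hpdef
  set x := 2 * s * p + s ^ 2 * N ^ 2 with hx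
  have hR : N + s * (p / N) + s ^ 2 / 2 * N = N + x / (2 * N) := by
    rw [hx]; field_simp; ring
  rw [hR]
  have hxN : 0 ≤ N + x / (2 * N) := by
    have : N + x / (2 * N) = (2 * N ^ 2 + x) / (2 * N) := by field_simp
    rw [this]
    refine div_nonneg ?_ (by positivity)
    have h1 : -(|s| * N ^ 2) ≤ s * p := by
      have h3 : |s * p| ≤ |s| * N ^ 2 := by
        rw [abs_mul]; exact mul_le_mul_of_nonneg_left hp (abs_nonneg s)
      linarith [neg_abs_le (s * p)]
    have h2 : 0 ≤ N ^ 2 * (1 + (1 - |s|) ^ 2) := by positivity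
    rw [hx]
    nlinarith [sq_abs s]
  refine le_of_sq_le_sq ?_ hxN
  rw [hsq]
  have e : (N + x / (2 * N)) ^ 2 = N ^ 2 + x + (x / (2 * N)) ^ 2 := by field_simp; ring
  rw [e, hx]
  nlinarith [sq_nonneg (x / (2 * N)), sq_nonneg s]

variable {Ω : Type*} [MeasurableSpace Ω] {m : Measure Ω}

theorem integrable_apply_mul_div {W : Ω → E} (hW : Integrable W m) (i k : Fin n) :
    Integrable (fun ω => W ω i * W ω k / ‖W ω‖) m := by
  refine hW.norm.mono' ?_ (Eventually.of_forall fun ω => ?_)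
  · have h : ∀ j : Fin n, AEStronglyMeasurable (fun ω => W ω j) m := fun j =>
      (by fun_prop : Continuous fun x : E => x j).comp_aestronglyMeasurable hW.1
    exact (((h i).mul (h k)).aemeasurable.div hW.1.norm.aemeasurable).aestronglyMeasurable
  · rw [norm_div, norm_norm]
    refine div_le_of_le_mul₀ (norm_nonneg _) (norm_nonneg _) ?_
    rw [← sq]
    exact abs_apply_mul_le _ _ _

/-- First order optimality conditions for a vector field in minimal position. -/
theorem isotropic_of_minimal {W : Ω → E} (hW : Integrable W m) (h1 : ∫ ω, ‖W ω‖ ∂m = 1)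
    (hmin : ∀ (B : E →L[ℝ] E) (t : ℝ), 0 < t → ∫ ω, ‖B (W ω)‖ ∂m ≤ t → |B.det| ≤ t ^ n)
    (i k : Fin n) :
    n * ∫ ω, W ω i * W ω k / ‖W ω‖ ∂m = if i = k then 1 else 0 := by
  set S := ∫ ω, W ω i * W ω k / ‖W ω‖ ∂m with hS
  set δ : ℝ := if i = k then 1 else 0 with hδ
  have hSint := integrable_apply_mul_div hW i k
  have hS1 : |S| ≤ 1 := by
    rw [← h1]
    refine (norm_integral_le_integral_norm _).trans
      (integral_mono hSint.norm hW.norm fun ω => ?_)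
    simp only
    rw [norm_div, norm_norm]
    refine div_le_of_le_mul₀ (norm_nonneg _) (norm_nonneg _) ?_
    rw [← sq]
    exact abs_apply_mul_le _ _ _
  -- Perturb by the elementary matrix `I + s E_ik`, of determinant `1 + s δ`, and use minimality.
  -- Equality at `s = 0` forces equal derivatives there: `n S = δ`.
  have key : ∀ s : ℝ, 1 + s * δ ≤ (1 + s * S + s ^ 2 / 2) ^ n := by
    intro s
    let f : E →ₗ[ℝ] ℝ := (innerSL ℝ (EuclideanSpace.single k (1 : ℝ) : E)).toLinearMap
    let B : E →L[ℝ] E := LinearMap.toContinuousLinearMap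
      (LinearMap.transvection f (s • EuclideanSpace.single i (1 : ℝ)))
    have hB : ∀ w, B w = w + (s * w k) • EuclideanSpace.single i (1 : ℝ) := by
      intro w
      have h : B w = w + f w • (s • EuclideanSpace.single i (1 : ℝ)) := rfl
      have hf : f w = w k := by
        refine (EuclideanSpace.inner_single_left k (1 : ℝ) w).trans ?_
        simp
      rw [h, hf, smul_smul, mul_comm]
    have hdet : B.det = 1 + s * δ := by
      have h : B.det = LinearMap.det (LinearMap.transvection f
        (s • EuclideanSpace.single i (1 : ℝ))) := rfl
      rw [h, LinearMap.transvection.det, map_smul]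
      have hf : f (EuclideanSpace.single i (1 : ℝ)) = δ := by
        refine (EuclideanSpace.inner_single_left k (1 : ℝ) _).trans ?_
        simp [hδ, eq_comm]
      rw [hf, smul_eq_mul]
    have ht : 0 < 1 + s * S + s ^ 2 / 2 := by
      have h2 : -|s| ≤ s * S := by
        have h3 : |s * S| ≤ |s| := by
          rw [abs_mul]; exact mul_le_of_le_one_right (abs_nonneg s) hS1
        linarith [neg_abs_le (s * S)]
      nlinarith [sq_abs s, sq_nonneg (1 - |s|)]
    rw [← hdet]
    refine (le_abs_self _).trans (hmin B _ ht ?_)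
    calc ∫ ω, ‖B (W ω)‖ ∂m
        ≤ ∫ ω, (‖W ω‖ + s * (W ω i * W ω k / ‖W ω‖) + s ^ 2 / 2 * ‖W ω‖) ∂m := by
          refine integral_mono (B.integrable_comp hW).norm
            ((hW.norm.add (hSint.const_mul s)).add (hW.norm.const_mul _)) fun ω => ?_
          simp only [hB]
          exact norm_add_smul_single_le _ _ _ _
      _ = 1 + s * S + s ^ 2 / 2 := by
          have hi : Integrable (fun ω => ‖W ω‖ + s * (W ω i * W ω k / ‖W ω‖)) m :=
            hW.norm.add (hSint.const_mul s)
          rw [integral_add hi (hW.norm.const_mul _), integral_add hW.norm (hSint.const_mul s),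
            integral_const_mul, integral_const_mul, h1,
            mul_one]
  let φ : ℝ → ℝ := fun s => (1 + s * S + s ^ 2 / 2) ^ n - (1 + s * δ)
  have hmin0 : IsLocalMin φ 0 := by
    refine Eventually.of_forall fun s => ?_
    have : φ 0 = 0 := by simp [φ]
    rw [this]
    exact sub_nonneg.2 (key s)
  have hd : HasDerivAt φ (n * S - δ) 0 := by
    have h2 : HasDerivAt (fun s : ℝ => 1 + s * S + s ^ 2 / 2) S 0 := by
      have := (((hasDerivAt_id' (0 : ℝ)).mul_const S).const_add 1).add
        (((hasDerivAt_id' (0 : ℝ)).pow 2).div_const 2)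
      exact this.congr_deriv (by simp)
    have h3 := (h2.pow n).sub (((hasDerivAt_id' (0 : ℝ)).mul_const δ).const_add 1)
    exact h3.congr_deriv (by simp)
  have := hmin0.hasDerivAt_eq_zero hd
  linarith

/-- The mixed discriminant of an isotropic vector field. -/
theorem integral_vecDet_sq_div [SigmaFinite m] (hn : 0 < n) {W : Ω → E} (hW : Integrable W m)
    (hiso : ∀ i k : Fin n,
      n * ∫ ω, W ω i * W ω k / ‖W ω‖ ∂m = if i = k then 1 else 0) :
    ∫ ω : Fin n → Ω, vecDet (fun i => W (ω i)) ^ 2 / ∏ i, ‖W (ω i)‖ ∂(Measure.pi fun _ => m) =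
      n.factorial / n ^ n := by
  have hn' : (n : ℝ) ≠ 0 := by exact_mod_cast hn.ne'
  have hS : ∀ i k : Fin n, ∫ ω, W ω i * W ω k / ‖W ω‖ ∂m = if i = k then (1 / n : ℝ) else 0 := by
    intro i k
    have := hiso i k
    split_ifs at this ⊢ with h
    · field_simp; linarith
    · exact (mul_eq_zero.1 this).resolve_left hn'
  -- After expanding both determinants, Fubini factors each term into second moments, which vanish
  -- unless `σ = τ`. There remain `n!` terms equal to `n⁻ⁿ`.
  have hexp : ∀ ω : Fin n → Ω, vecDet (fun i => W (ω i)) ^ 2 / ∏ i, ‖W (ω i)‖ =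
      ∑ σ : Equiv.Perm (Fin n), ∑ τ : Equiv.Perm (Fin n),
        (((Equiv.Perm.sign σ : ℤ) : ℝ) * ((Equiv.Perm.sign τ : ℤ) : ℝ)) *
          ∏ i, (W (ω i) (σ i) * W (ω i) (τ i) / ‖W (ω i)‖) := by
    intro ω
    rw [vecDet_eq_sum, sq, Finset.sum_mul_sum, Finset.sum_div]
    refine Finset.sum_congr rfl fun σ _ => ?_
    rw [Finset.sum_div]
    refine Finset.sum_congr rfl fun τ _ => ?_
    rw [Finset.prod_div_distrib, Finset.prod_mul_distrib]
    ring
  have hint : ∀ σ τ : Equiv.Perm (Fin n), Integrable (fun ω : Fin n → Ω =>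
      (((Equiv.Perm.sign σ : ℤ) : ℝ) * ((Equiv.Perm.sign τ : ℤ) : ℝ)) *
          ∏ i, (W (ω i) (σ i) * W (ω i) (τ i) / ‖W (ω i)‖)) (Measure.pi fun _ => m) :=
    fun σ τ => (Integrable.fintype_prod
      (f := fun i ω => W ω (σ i) * W ω (τ i) / ‖W ω‖)
      fun i => integrable_apply_mul_div hW (σ i) (τ i)).const_mul _
  simp only [hexp]
  rw [integral_finsetSum _ fun σ _ => integrable_finsetSum _ fun τ _ => hint σ τ]
  have hinner : ∀ σ : Equiv.Perm (Fin n), ∫ ω : Fin n → Ω, ∑ τ : Equiv.Perm (Fin n),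
      (((Equiv.Perm.sign σ : ℤ) : ℝ) * ((Equiv.Perm.sign τ : ℤ) : ℝ)) *
          ∏ i, (W (ω i) (σ i) * W (ω i) (τ i) / ‖W (ω i)‖) ∂(Measure.pi fun _ => m) =
      (1 / n) ^ n := by
    intro σ
    rw [integral_finsetSum _ fun τ _ => hint σ τ]
    have hprod : ∀ τ : Equiv.Perm (Fin n), ∫ ω : Fin n → Ω,
        (((Equiv.Perm.sign σ : ℤ) : ℝ) * ((Equiv.Perm.sign τ : ℤ) : ℝ)) *
          ∏ i, (W (ω i) (σ i) * W (ω i) (τ i) / ‖W (ω i)‖) ∂(Measure.pi fun _ => m) =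
        (((Equiv.Perm.sign σ : ℤ) : ℝ) * ((Equiv.Perm.sign τ : ℤ) : ℝ)) *
          ∏ i, if σ i = τ i then (1 / n : ℝ) else 0 := by
      intro τ
      rw [integral_const_mul, integral_fintype_prod_eq_prod
        (f := fun i ω => W ω (σ i) * W ω (τ i) / ‖W ω‖)]
      simp only [hS]
    simp only [hprod]
    rw [Finset.sum_eq_single σ]
    · simp only [if_true, Finset.prod_const, Finset.card_univ, Fintype.card_fin]
      rw [← Int.cast_mul, Int.units_coe_mul_self, Int.cast_one, one_mul]
    · intro τ _ hτ
      obtain ⟨i, hi⟩ : ∃ i, σ i ≠ τ i := by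
        by_contra h
        push Not at h
        exact hτ (Equiv.ext fun i => (h i).symm)
      rw [Finset.prod_eq_zero (Finset.mem_univ i) (by rw [if_neg hi]), mul_zero]
    · simp
  simp only [hinner, Finset.sum_const, Finset.card_univ, Fintype.card_perm, Fintype.card_fin,
    nsmul_eq_mul]
  rw [one_div, inv_pow, div_eq_mul_inv]

theorem integrable_abs_vecDet [SigmaFinite m] {W : Ω → E} (hW : Integrable W m) :
    Integrable (fun ω : Fin n → Ω => |vecDet (fun i => W (ω i))|) (Measure.pi fun _ => m) := by
  have hint : Integrable (fun ω : Fin n → Ω => ∏ i, ‖W (ω i)‖) (Measure.pi fun _ => m) :=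
    Integrable.fintype_prod (f := fun _ ω => ‖W ω‖) fun _ => hW.norm
  refine hint.mono' ?_ (Eventually.of_forall fun ω => ?_)
  · have h : Continuous fun v : Fin n → E => |vecDet v| := by
      simp only [vecDet_eq_sum]
      fun_prop
    refine h.comp_aestronglyMeasurable (f := fun (ω : Fin n → Ω) i => W (ω i)) ?_
    refine (aemeasurable_pi_lambda _ fun i => ?_).aestronglyMeasurable
    exact hW.1.aemeasurable.comp_quasiMeasurePreserving (Measure.quasiMeasurePreserving_eval _ i)
  · rw [Real.norm_eq_abs, abs_abs]
    exact abs_vecDet_le _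

/-- A nondegenerate integrable vector field can be put in a unimodular linear position in which
its `L¹` norm is controlled by the average determinant of `n` independent copies. -/
theorem exists_unimodular_position [SigmaFinite m] (hn : 0 < n) {V : Ω → E} (hV : Integrable V m)
    (hnd : ∀ u : E, ∫ ω, |inner ℝ (V ω) u| ∂m = 0 → u = 0) :
    ∃ B : E →L[ℝ] E, |B.det| = 1 ∧ n.factorial * (∫ ω, ‖B (V ω)‖ ∂m) ^ n ≤
      n ^ n * ∫ ω : Fin n → Ω, |vecDet (fun i => V (ω i))| ∂(Measure.pi fun _ => m) := by
  have : Nontrivial E := by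
    have : Nonempty (Fin n) := ⟨⟨0, hn⟩⟩
    infer_instance
  let τ : (E →L[ℝ] E) → ℝ := fun B => ∫ ω, ‖B (V ω)‖ ∂m
  have hint : ∀ B : E →L[ℝ] E, Integrable (fun ω => ‖B (V ω)‖) m := fun B =>
    (B.integrable_comp hV).norm
  have hτ0 : ∀ B, 0 ≤ τ B := fun B => integral_nonneg fun ω => norm_nonneg _
  have hτs : ∀ (r : ℝ) B, τ (r • B) = |r| * τ B := by
    intro r B
    simp only [τ, _root_.smul_apply, norm_smul, Real.norm_eq_abs]
    exact integral_const_mul _ _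
  -- Nondegeneracy of `V` makes `τ` a norm on matrices; its unit ball is then compact.
  have hτz : ∀ B, τ B = 0 → B = 0 := by
    intro B hB
    have hae : (fun ω => ‖B (V ω)‖) =ᵐ[m] 0 :=
      (integral_eq_zero_iff_of_nonneg (fun ω => norm_nonneg _) (hint B)).1 hB
    have hadj : ∀ y, ContinuousLinearMap.adjoint B y = 0 := by
      intro y
      refine hnd _ (integral_eq_zero_of_ae ?_)
      filter_upwards [hae] with ω hω
      have : B (V ω) = 0 := by simpa using hω
      rw [ContinuousLinearMap.adjoint_inner_right, this]
      simp
    have : ContinuousLinearMap.adjoint B = 0 := ContinuousLinearMap.ext hadj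
    simpa using this
  have hτc : Continuous τ := by
    have : LipschitzWith (Real.toNNReal (∫ ω, ‖V ω‖ ∂m)) τ := by
      refine LipschitzWith.of_le_add_mul _ fun B B' => ?_
      rw [Real.coe_toNNReal _ (integral_nonneg fun ω => norm_nonneg _), dist_eq_norm]
      calc τ B ≤ ∫ ω, (‖B' (V ω)‖ + ‖B - B'‖ * ‖V ω‖) ∂m := by
            refine integral_mono (hint B) ((hint B').add (hV.norm.const_mul _)) fun ω => ?_
            have e : B (V ω) = B' (V ω) + (B - B') (V ω) := by simp
            simp only
            rw [e]
            exact (norm_add_le _ _).trans (by gcongr; exact (B - B').le_opNorm _)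
        _ = τ B' + (∫ ω, ‖V ω‖ ∂m) * ‖B - B'‖ := by
            rw [integral_add (hint B') (hV.norm.const_mul _), integral_const_mul, mul_comm]
    exact this.continuous
  obtain ⟨B₀, hB₀, hB₀min⟩ := (isCompact_sphere (0 : E →L[ℝ] E) 1).exists_isMinOn
    ⟨ContinuousLinearMap.id ℝ E, by simp⟩ hτc.continuousOn
  have hc : 0 < τ B₀ := by
    refine lt_of_le_of_ne (hτ0 _) fun h => ?_
    have := hτz B₀ h.symm
    simp [this] at hB₀
  have hlow : ∀ B, τ B₀ * ‖B‖ ≤ τ B := by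
    intro B
    rcases eq_or_ne B 0 with rfl | hB
    · simp [τ]
    have hB' : 0 < ‖B‖ := norm_pos_iff.2 hB
    have h1 : τ B₀ ≤ τ (‖B‖⁻¹ • B) := hB₀min (by simp [norm_smul, hB'.ne'])
    rw [hτs, abs_of_pos (by positivity), le_inv_mul_iff₀ hB'] at h1
    linarith
  set 𝒦 : Set (E →L[ℝ] E) := {B | τ B ≤ 1} with h𝒦
  have h𝒦c : IsCompact 𝒦 := by
    refine Metric.isCompact_of_isClosed_isBounded (isClosed_le hτc continuous_const) ?_
    refine (Metric.isBounded_closedBall (x := (0 : E →L[ℝ] E)) (r := 1 / τ B₀)).subset fun B hB => ?_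
    rw [mem_closedBall_zero_iff, le_div_iff₀ hc, mul_comm]
    exact (hlow B).trans hB
  -- By homogeneity, maximizing `|det|` subject to `τ ≤ 1` is minimizing `τ` subject to `|det| = 1`.
  obtain ⟨A, hA, hAmax⟩ := h𝒦c.exists_isMaxOn ⟨0, by simp [h𝒦, τ]⟩
    (ContinuousLinearMap.continuous_det.abs.continuousOn (s := 𝒦))
  have hτ1 : 0 < τ (ContinuousLinearMap.id ℝ E) := by
    have := hlow (ContinuousLinearMap.id ℝ E)
    rw [ContinuousLinearMap.norm_id, mul_one] at this
    exact hc.trans_le this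
  have hdetA : 0 < |A.det| := by
    have hmem : (τ (ContinuousLinearMap.id ℝ E))⁻¹ • ContinuousLinearMap.id ℝ E ∈ 𝒦 := by
      simp only [h𝒦, mem_ofPred_eq]
      rw [hτs, abs_of_pos (by positivity), inv_mul_cancel₀ hτ1.ne']
    have h1 : |((τ (ContinuousLinearMap.id ℝ E))⁻¹ • ContinuousLinearMap.id ℝ E).det| ≤ |A.det| :=
      hAmax hmem
    rw [det_smul_clm] at h1
    have h2 : (ContinuousLinearMap.id ℝ E).det = 1 := LinearMap.det_id
    rw [h2, mul_one, abs_of_pos (by positivity)] at h1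
    exact lt_of_lt_of_le (by positivity) h1
  set W : Ω → E := fun ω => A (V ω) with hW
  have hWint : Integrable W m := A.integrable_comp hV
  have hmin : ∀ (B : E →L[ℝ] E) (t : ℝ), 0 < t → ∫ ω, ‖B (W ω)‖ ∂m ≤ t → |B.det| ≤ t ^ n := by
    intro B t ht hB
    have hmem : t⁻¹ • (B ∘L A) ∈ 𝒦 := by
      simp only [h𝒦, mem_ofPred_eq]
      rw [hτs, abs_of_pos (by positivity), inv_mul_le_iff₀ ht, mul_one]
      exact hB
    have h1 : |(t⁻¹ • (B ∘L A)).det| ≤ |A.det| := hAmax hmem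
    have h2 : (B ∘L A).det = B.det * A.det := LinearMap.det_comp _ _
    rw [det_smul_clm, h2, ← mul_assoc, abs_mul] at h1
    have h3 : |t⁻¹ ^ n * B.det| ≤ 1 := by
      by_contra h
      rw [not_le] at h
      nlinarith
    rwa [abs_mul, abs_of_pos (by positivity), inv_pow, inv_mul_le_iff₀ (by positivity),
      mul_one] at h3
  have hW1 : ∫ ω, ‖W ω‖ ∂m = 1 := by
    refine le_antisymm hA ?_
    by_contra h
    rw [not_le] at h
    have h0 : 0 ≤ ∫ ω, ‖W ω‖ ∂m := integral_nonneg fun ω => norm_nonneg _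
    set t := ((∫ ω, ‖W ω‖ ∂m) + 1) / 2 with ht
    have h1 := hmin (ContinuousLinearMap.id ℝ E) t (by linarith)
      (by simp only [ContinuousLinearMap.id_apply]; linarith)
    have h2 : (ContinuousLinearMap.id ℝ E).det = 1 := LinearMap.det_id
    rw [h2, abs_one] at h1
    have h3 : t ^ n < 1 := pow_lt_one₀ (by linarith) (by linarith) hn.ne'
    linarith
  have hiso := isotropic_of_minimal hWint hW1 hmin
  have hdisc := integral_vecDet_sq_div hn hWint hiso
  set D := ∫ ω : Fin n → Ω, |vecDet (fun i => V (ω i))| ∂(Measure.pi fun _ => m) with hD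
  -- Hadamard bounds the squared determinant over the product of norms by the determinant itself,
  -- which is linear in `det A`.
  have hle : (n.factorial : ℝ) / n ^ n ≤ |A.det| * D := by
    rw [← hdisc, hD, ← integral_const_mul]
    refine integral_mono_of_nonneg (Eventually.of_forall fun ω => by positivity)
      ((integrable_abs_vecDet hV).const_mul _) (Eventually.of_forall fun ω => ?_)
    simp only
    have e : vecDet (fun i => W (ω i)) = A.det * vecDet (fun i => V (ω i)) := vecDet_comp A _
    rw [← abs_mul, ← e, ← sq_abs]
    refine div_le_of_le_mul₀ (by positivity) (abs_nonneg _) ?_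
    rw [sq]
    gcongr
    exact abs_vecDet_le _
  have hn' : (0 : ℝ) < n := by exact_mod_cast hn
  set r : ℝ := |A.det| ^ (-(1 / n : ℝ)) with hr
  have hr0 : 0 < r := Real.rpow_pos_of_pos hdetA _
  have hrn : r ^ n = |A.det|⁻¹ := by
    rw [hr, ← Real.rpow_natCast, ← Real.rpow_mul hdetA.le, neg_mul, one_div_mul_cancel hn'.ne',
      Real.rpow_neg_one]
  refine ⟨r • A, ?_, ?_⟩
  · rw [det_smul_clm, abs_mul, abs_of_pos (by positivity), hrn, inv_mul_cancel₀ hdetA.ne']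
  · have h1 : ∫ ω, ‖(r • A) (V ω)‖ ∂m = r := by
      have := hτs r A
      rw [abs_of_pos hr0] at this
      simp only [τ] at this
      rw [this]
      have h2 : ∫ ω, ‖A (V ω)‖ ∂m = 1 := hW1
      rw [h2, mul_one]
    rw [h1, hrn, ← div_eq_mul_inv, div_le_iff₀ hdetA]
    rw [div_le_iff₀ (by positivity)] at hle
    linarith

end IsotropicPosition

/-! ### Dyadic layers, average determinants, perimeters from gradients. -/

section Layers

/-- Dyadic layers recover a bounded nonnegative number up to a factor `2`. -/
theorem dyadic_layers {M y : ℝ} (hM : 0 < M) (hy0 : 0 ≤ y) (hy : y ≤ M) :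
    ENNReal.ofReal y ≤ ∑' j : ℕ, (if M / 2 ^ (j + 1) ≤ y then ENNReal.ofReal (M / 2 ^ (j + 1))
      else 0) ∧
    ∑' j : ℕ, (if M / 2 ^ (j + 1) ≤ y then ENNReal.ofReal (M / 2 ^ (j + 1)) else 0) ≤
      2 * ENNReal.ofReal y := by
  set c : ℕ → ℝ := fun j => M / 2 ^ (j + 1) with hc
  have hc0 : ∀ j, 0 < c j := fun j => by positivity
  rcases hy0.eq_or_lt with rfl | hy0
  · simp
  have hex : ∃ j, c j ≤ y := by
    have hlim : Tendsto c atTop (𝓝 0) := by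
      have h1 : Tendsto (fun j : ℕ => M / 2 * (1 / 2 : ℝ) ^ j) atTop (𝓝 (M / 2 * 0)) :=
        (tendsto_pow_atTop_nhds_zero_of_lt_one (by norm_num) (by norm_num)).const_mul _
      rw [mul_zero] at h1
      refine h1.congr fun j => ?_
      simp only [hc, pow_succ, one_div, inv_pow]
      field_simp
    exact (hlim.eventually (gt_mem_nhds hy0)).exists.imp fun j hj => hj.le
  classical
  -- The active layers are those from `J` on; their geometric sum is `2 * c J`, and `c J ≤ y ≤ 2 * c
  -- J`.
  set J := Nat.find hex with hJ
  have hJy : c J ≤ y := Nat.find_spec hex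
  have hyJ : y ≤ 2 * c J := by
    rcases Nat.eq_zero_or_pos J with h | h
    · rw [h]; simp only [hc]; rw [zero_add, pow_one]; linarith
    · have h1 := Nat.find_min hex (Nat.sub_lt h one_pos)
      rw [not_le, ← hJ] at h1
      refine h1.le.trans (le_of_eq ?_)
      have h2 : J = (J - 1) + 1 := by omega
      conv_rhs => rw [h2]
      simp only [hc, pow_succ]
      field_simp
  have hanti : ∀ k, c (k + J) ≤ y := by
    intro k
    refine le_trans ?_ hJy
    simp only [hc]
    gcongr
    · norm_num
    · omega
  have hsum : ∑' j, (if c j ≤ y then ENNReal.ofReal (c j) else 0) =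
      ENNReal.ofReal (2 * c J) := by
    rw [← Summable.sum_add_tsum_nat_add' (k := J) ENNReal.summable]
    rw [Finset.sum_eq_zero fun i hi => if_neg (Nat.find_min hex (Finset.mem_range.1 hi)), zero_add]
    simp only [hanti, if_true]
    have hs : HasSum (fun k => c (k + J)) (2 * c J) := by
      have h1 : (fun k => c (k + J)) = fun k => c J * (1 / 2 : ℝ) ^ k := by
        ext k
        simp only [hc, one_div, inv_pow]
        field_simp
        ring
      have h2 : 2 * c J = c J * (1 - 1 / 2 : ℝ)⁻¹ := by norm_num; ring
      rw [h1, h2]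
      exact (hasSum_geometric_of_lt_one (by norm_num) (by norm_num)).mul_left _
    rw [← ENNReal.ofReal_tsum_of_nonneg (fun k => (hc0 _).le) hs.summable, hs.tsum_eq]
  rw [hsum]
  refine ⟨ENNReal.ofReal_le_ofReal hyJ, ?_⟩
  rw [ENNReal.ofReal_mul zero_le_two, ENNReal.ofReal_ofNat]
  gcongr

theorem tsum_dyadic {M : ℝ} (hM : 0 < M) :
    ∑' j : ℕ, ENNReal.ofReal (M / 2 ^ (j + 1)) ≤ 2 * ENNReal.ofReal M := by
  have h := (dyadic_layers hM hM.le le_rfl).2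
  have : ∀ j : ℕ, M / 2 ^ (j + 1) ≤ M := fun j => div_le_self hM.le (one_le_pow₀ one_le_two)
  simpa only [this, if_true] using h

theorem lintegral_fin_prod {Ω : Type*} [MeasurableSpace Ω] (m : Measure Ω) [SigmaFinite m] {n : ℕ}
    (φ : Fin n → Ω → ℝ≥0∞) (hφ : ∀ i, Measurable (φ i)) :
    ∫⁻ ω : Fin n → Ω, ∏ i, φ i (ω i) ∂(Measure.pi fun _ => m) = ∏ i, ∫⁻ ω, φ i ω ∂m := by
  induction n with
  | zero => simp
  | succ n ih =>
    have hm : ∀ {k : ℕ} (g : Fin k → Ω → ℝ≥0∞) (_ : ∀ i, Measurable (g i)),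
        Measurable fun ω : Fin k → Ω => ∏ i, g i (ω i) := fun g hg =>
      Finset.measurable_prod _ fun i _ => (hg i).comp (measurable_pi_apply i)
    rw [← ((measurePreserving_piFinSuccAbove (fun _ : Fin (n + 1) => m) 0).symm).lintegral_comp
      (hm φ hφ)]
    simp only [MeasurableEquiv.piFinSuccAbove_symm_apply, Fin.insertNthEquiv,
      Fin.prod_univ_succ, Fin.insertNth_zero, Equiv.coe_fn_mk, Fin.cons_succ,
      Fin.cons_zero, Fin.zero_succAbove, cast_eq]
    rw [lintegral_prod_mul (f := φ 0) (g := fun ω : Fin n → Ω => ∏ i, φ (Fin.succ i) (ω i))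
      (hφ 0).aemeasurable (hm _ fun i => hφ _).aemeasurable, ih _ fun i => hφ _]

variable {n : ℕ}

local notation "E" => EuclideanSpace ℝ (Fin n)

/-- Average determinants of a vector field whose pieces, indexed by labels, are controlled by
ellipsoids that increase with the label. -/
theorem lintegral_vecDet_le {Ω : Type*} [MeasurableSpace Ω] (m : Measure Ω) [SigmaFinite m]
    {V : Ω → E} (hV : Measurable V) {l : Ω → ℕ} (hl : Measurable l) (G : Set ℕ)
    (hG : ∀ ω, V ω ≠ 0 → l ω ∈ G) (A : ℕ → E →L[ℝ] E) (hA : ∀ j ∈ G, (A j).det ≠ 0)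
    (a : ℝ≥0∞) (b : ℕ → ℝ≥0∞)
    (ha : ∀ j ∈ G, ∫⁻ ω in {ω | j ≤ l ω}, ‖ContinuousLinearMap.adjoint (A j) (V ω)‖ₑ ∂m ≤ a)
    (hb : ∀ j ∈ G, ∫⁻ ω in {ω | l ω = j}, ‖ContinuousLinearMap.adjoint (A j) (V ω)‖ₑ ∂m ≤
      ENNReal.ofReal |(A j).det| * b j) (hn : 0 < n) :
    ∫⁻ ω : Fin n → Ω, ‖vecDet (fun i => V (ω i))‖ₑ ∂(Measure.pi fun _ => m) ≤
      n * (a ^ (n - 1) * ∑' j, b j) := by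
  classical
  -- The samples whose smallest label is `j`, attained at index `k`. The sum over `k` produces the
  -- factor `n`.
  let S : Fin n → ℕ → Fin n → Set Ω := fun k j i => if i = k then {ω | l ω = j} else {ω | j ≤ l ω}
  have hS : ∀ k j i, MeasurableSet (S k j i) := by
    intro k j i
    simp only [S]
    split_ifs
    · exact hl (measurableSet_singleton j)
    · exact measurableSet_le measurable_const hl
  let φ : Fin n → ℕ → Fin n → Ω → ℝ≥0∞ := fun k j i =>
    (S k j i).indicator fun ω => ‖ContinuousLinearMap.adjoint (A j) (V ω)‖ₑ
  have hφm : ∀ k j i, Measurable (φ k j i) := fun k j i =>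
    (((ContinuousLinearMap.adjoint (A j)).continuous.measurable.comp hV).enorm).indicator (hS k j i)
  let F : Fin n → ℕ → (Fin n → Ω) → ℝ≥0∞ := fun k j ω =>
    (if j ∈ G then ENNReal.ofReal |(A j).det|⁻¹ else 0) * ∏ i, φ k j i (ω i)
  have hFm : ∀ k j, Measurable (F k j) := fun k j =>
    (Finset.measurable_prod _ fun i _ => (hφm k j i).comp (measurable_pi_apply i)).const_mul _
  have hpt : ∀ ω : Fin n → Ω, ‖vecDet (fun i => V (ω i))‖ₑ ≤ ∑ k, ∑' j, F k j ω := by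
    intro ω
    by_cases h0 : ∃ i, V (ω i) = 0
    · obtain ⟨i, hi⟩ := h0
      have : vecDet (fun i => V (ω i)) = 0 := by
        rw [← abs_eq_zero]
        refine le_antisymm ((abs_vecDet_le _).trans ?_) (abs_nonneg _)
        rw [Finset.prod_eq_zero (Finset.mem_univ i) (by rw [hi, norm_zero])]
      rw [this, enorm_zero]
      exact zero_le
    push Not at h0
    obtain ⟨k, -, hk⟩ := Finset.exists_min_image (Finset.univ : Finset (Fin n)) (fun i => l (ω i))
      ⟨⟨0, hn⟩, Finset.mem_univ _⟩
    set j := l (ω k) with hj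
    have hjG : j ∈ G := hG _ (h0 k)
    have hφ : ∀ i, φ k j i (ω i) = ‖ContinuousLinearMap.adjoint (A j) (V (ω i))‖ₑ := by
      intro i
      refine indicator_of_mem ?_ _
      simp only [S]
      split_ifs with h
      · rw [h]; exact hj.symm
      · exact hk i (Finset.mem_univ i)
    calc ‖vecDet (fun i => V (ω i))‖ₑ ≤ F k j ω := by
          simp only [F, if_pos hjG, hφ]
          -- Hadamard is applied after the change of coordinates adapted to the smallest level set,
          -- at the price of `|det A_j|⁻¹`.
          have hd := vecDet_comp (ContinuousLinearMap.adjoint (A j)) (fun i => V (ω i))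
          rw [det_adjoint_eq] at hd
          have h1 := abs_vecDet_le (fun i => ContinuousLinearMap.adjoint (A j) (V (ω i)))
          rw [hd, abs_mul] at h1
          have h2 : |vecDet (fun i => V (ω i))| ≤ |(A j).det|⁻¹ *
              ∏ i, ‖ContinuousLinearMap.adjoint (A j) (V (ω i))‖ := by
            rw [le_inv_mul_iff₀ (abs_pos.2 (hA j hjG))]
            exact h1
          have h3 := ENNReal.ofReal_le_ofReal h2
          rw [ENNReal.ofReal_mul (by positivity),
            ENNReal.ofReal_prod_of_nonneg fun i _ => norm_nonneg _] at h3
          simpa only [ofReal_norm, Real.enorm_eq_ofReal_abs] using h3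
      _ ≤ ∑' j, F k j ω := ENNReal.le_tsum j
      _ ≤ _ := Finset.single_le_sum (f := fun k => ∑' j, F k j ω) (fun _ _ => zero_le)
          (Finset.mem_univ k)
  have hF : ∀ k j, ∫⁻ ω, F k j ω ∂(Measure.pi fun _ => m) ≤ a ^ (n - 1) * b j := by
    intro k j
    simp only [F]
    have hm : Measurable fun ω : Fin n → Ω => ∏ i, φ k j i (ω i) :=
      Finset.measurable_prod _ fun i _ => (hφm k j i).comp (measurable_pi_apply i)
    rw [lintegral_const_mul _ hm, lintegral_fin_prod m _ (hφm k j)]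
    split_ifs with hjG
    · have hint : ∀ i, ∫⁻ ω, φ k j i ω ∂m =
          ∫⁻ ω in S k j i, ‖ContinuousLinearMap.adjoint (A j) (V ω)‖ₑ ∂m := fun i =>
        lintegral_indicator (hS k j i) _
      simp only [hint]
      rw [← Finset.mul_prod_erase _ _ (Finset.mem_univ k)]
      have h1 : ∫⁻ ω in S k j k, ‖ContinuousLinearMap.adjoint (A j) (V ω)‖ₑ ∂m ≤
          ENNReal.ofReal |(A j).det| * b j := by
        simpa only [S, if_true] using hb j hjG
      have h2 : ∏ i ∈ Finset.univ.erase k,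
          ∫⁻ ω in S k j i, ‖ContinuousLinearMap.adjoint (A j) (V ω)‖ₑ ∂m ≤ a ^ (n - 1) := by
        have := Finset.prod_le_pow_card (Finset.univ.erase k)
          (fun i => ∫⁻ ω in S k j i, ‖ContinuousLinearMap.adjoint (A j) (V ω)‖ₑ ∂m) a
          (fun i hi => by simpa only [S, if_neg (Finset.ne_of_mem_erase hi)] using ha j hjG)
        rwa [Finset.card_erase_of_mem (Finset.mem_univ k), Finset.card_univ,
          Fintype.card_fin] at this
      have hd := abs_pos.2 (hA j hjG)
      calc _ ≤ ENNReal.ofReal |(A j).det|⁻¹ *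
            ((ENNReal.ofReal |(A j).det| * b j) * a ^ (n - 1)) := by gcongr
        _ = (ENNReal.ofReal |(A j).det|⁻¹ * ENNReal.ofReal |(A j).det|) *
            (a ^ (n - 1) * b j) := by ring
        _ = _ := by
          rw [← ENNReal.ofReal_mul (by positivity), inv_mul_cancel₀ hd.ne', ENNReal.ofReal_one,
            one_mul]
    · rw [zero_mul]; exact zero_le
  calc _ ≤ ∫⁻ ω : Fin n → Ω, ∑ k, ∑' j, F k j ω ∂(Measure.pi fun _ => m) := lintegral_mono hpt
    _ = ∑ k, ∑' j, ∫⁻ ω, F k j ω ∂(Measure.pi fun _ => m) := by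
        rw [lintegral_finsetSum _ fun k _ => Measurable.tsum fun j => hFm k j]
        exact Finset.sum_congr rfl fun k _ => lintegral_tsum fun j => (hFm k j).aemeasurable
    _ ≤ ∑ _k : Fin n, ∑' j, a ^ (n - 1) * b j :=
        Finset.sum_le_sum fun k _ => ENNReal.tsum_le_tsum fun j => hF k j
    _ = _ := by
        rw [ENNReal.tsum_mul_left, Finset.sum_const, Finset.card_univ, Fintype.card_fin,
          nsmul_eq_mul]

theorem lintegral_count_prod (F : ℕ × E → ℝ≥0∞) (hF : Measurable F) :
    ∫⁻ p, F p ∂(Measure.count.prod volume) = ∑' j, ∫⁻ x, F (j, x) := by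
  rw [lintegral_prod _ hF.aemeasurable, lintegral_count]

theorem image_mem_sum_segment {F F' ι : Type*} [AddCommGroup F] [Module ℝ F] [AddCommGroup F']
    [Module ℝ F'] (A : F →ₗ[ℝ] F') (s : Finset ι) (w : ι → F) {y : F}
    (hy : y ∈ ∑ i ∈ s, segment ℝ (0 : F) (w i)) :
    A y ∈ ∑ i ∈ s, segment ℝ (0 : F') (A (w i)) := by
  obtain ⟨g, hg, rfl⟩ := (Set.mem_finsetSum _ _ _).1 hy
  rw [map_sum]
  refine Set.finsetSum_mem_finsetSum _ _ _ fun i hi => ?_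
  have := hg hi
  rw [segment_eq_image] at this ⊢
  obtain ⟨t, ht, h⟩ := this
  refine ⟨t, ht, ?_⟩
  simp only [smul_zero, zero_add] at h ⊢
  rw [← h, map_smul]

/-- The maximal perimeter in terms of the gradients of Lipschitz layers majorizing the density. -/
theorem maxPerimeter_map_le (f : E → ℝ≥0∞) (c : ℕ → ℝ) (hc : ∀ j, 0 ≤ c j) (q : ℕ → E → ℝ)
    (hq : ∀ j, ∃ C, LipschitzWith C (q j)) (hqc : ∀ j, HasCompactSupport (q j))
    (hf : ∀ᵐ x, f x ≤ ∑' j, ENNReal.ofReal (c j) * ENNReal.ofReal (q j x))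
    (V : ℕ × E → E) (hVm : Measurable V) (hV : ∀ p, V p = c p.1 • gradient (q p.1) p.2)
    (T : E ≃L[ℝ] E) :
    maxPerimeter (((volume : Measure E).withDensity f).map T) ≤
      4 * ∫⁻ p, ‖ContinuousLinearMap.adjoint (T.symm : E →L[ℝ] E) (V p)‖ₑ
        ∂(Measure.count.prod volume) := by
  set B := ContinuousLinearMap.adjoint (T.symm : E →L[ℝ] E) with hB
  refine iSup₂_le fun Q hQ => perimeter_le_of_forall fun ε hε => ?_
  have hmap : ∀ S : Set E, ((volume : Measure E).withDensity f).map T S =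
      (volume : Measure E).withDensity f (T ⁻¹' S) := fun S =>
    T.toHomeomorph.toMeasurableEquiv.map_apply S
  rw [hmap]
  -- Pulled back by `T`, the neighbourhood of `Q` lies in a sweep of the convex set `T⁻¹ Q` along
  -- these vectors.
  let w : Finset (Fin n) → E := fun s => T.symm (ε • (4 / 2 ^ n : ℝ) • signVector s)
  set Q' : Set E := T ⁻¹' Q with hQ'
  have hQ'c : Convex ℝ Q' := hQ.is_linear_preimage T.toLinearMap.isLinear
  have hsub : T ⁻¹' ((Q + ε • Metric.closedBall (0 : E) 1) \ Q) ⊆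
      (Q' + ∑ s : Finset (Fin n), segment ℝ 0 (w s)) \ Q' := by
    rintro x ⟨⟨y, hy, z, hz, hyz⟩, hxQ⟩
    refine ⟨⟨T.symm y, by simpa [hQ'] using hy, T.symm z, ?_, ?_⟩, hxQ⟩
    · exact image_mem_sum_segment T.symm.toLinearMap Finset.univ _
        (smul_sum_segment_subset _ _ _ (smul_set_mono closedBall_subset_zonotope hz))
    · have h1 : y + z = T x := hyz
      have h2 : T.symm y + T.symm z = T.symm (T x) := by rw [← h1, map_add]
      simpa using h2
  set W := (Q' + ∑ s : Finset (Fin n), segment ℝ 0 (w s)) \ Q' with hW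
  have hqcont : ∀ j, Continuous (q j) := fun j => (hq j).choose_spec.continuous
  have hinner : ∀ (p : ℕ × E) (s : Finset (Fin n)),
      (inner ℝ (V p) (w s) : ℝ) = ε * (4 / 2 ^ n) * inner ℝ (B (V p)) (signVector s) := by
    intro p s
    rw [hB, ContinuousLinearMap.adjoint_inner_left]
    simp only [w, map_smul, inner_smul_right]
    rw [mul_assoc]
    rfl
  have hlayer : ∀ j, ∫⁻ x in W, ENNReal.ofReal (q j x) ≤
      ∑ s, ∫⁻ x, ‖(inner ℝ (gradient (q j) x) (w s) : ℝ)‖ₑ := by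
    intro j
    obtain ⟨C, hC⟩ := hq j
    have hm : Measurable fun x => ENNReal.ofReal (q j x) :=
      ENNReal.measurable_ofReal.comp (hqcont j).measurable
    refine (setLIntegral_zonotope_le volume Finset.univ w hQ'c hm.aemeasurable ?_).trans ?_
    · have hi : Integrable (q j) := (hqcont j).integrable_of_hasCompactSupport (hqc j)
      exact (lt_of_le_of_lt (lintegral_mono fun x => Real.ofReal_le_enorm _)
        hi.hasFiniteIntegral).ne
    · refine Finset.sum_le_sum fun s _ => le_trans (lintegral_mono fun x => ?_)
        (lintegral_increment_le (q j) hC (hqc j) (w s))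
      rw [tsub_le_iff_left, Real.enorm_eq_ofReal_abs]
      refine le_trans (ENNReal.ofReal_le_ofReal ?_) ENNReal.ofReal_add_le
      linarith [neg_abs_le (q j (x + w s) - q j x)]
  calc (volume : Measure E).withDensity f (T ⁻¹' ((Q + ε • Metric.closedBall (0 : E) 1) \ Q))
      ≤ (volume : Measure E).withDensity f W := measure_mono hsub
    _ = ∫⁻ x in W, f x := withDensity_apply' _ _
    _ ≤ ∫⁻ x in W, ∑' j, ENNReal.ofReal (c j) * ENNReal.ofReal (q j x) :=
        lintegral_mono_ae (ae_restrict_of_ae hf)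
    _ = ∑' j, ENNReal.ofReal (c j) * ∫⁻ x in W, ENNReal.ofReal (q j x) := by
        have hm : ∀ j, Measurable fun x => ENNReal.ofReal (q j x) := fun j =>
          ENNReal.measurable_ofReal.comp (hqcont j).measurable
        rw [lintegral_tsum fun j => ((hm j).const_mul _).aemeasurable]
        exact tsum_congr fun j => lintegral_const_mul _ (hm j)
    _ ≤ ∑' j, ENNReal.ofReal (c j) *
          ∑ s, ∫⁻ x, ‖(inner ℝ (gradient (q j) x) (w s) : ℝ)‖ₑ := by
        gcongr with j
        exact hlayer j
    _ = ∑' j, ∑ s, ∫⁻ x, ‖(inner ℝ (V (j, x)) (w s) : ℝ)‖ₑ := by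
        refine tsum_congr fun j => ?_
        rw [Finset.mul_sum]
        refine Finset.sum_congr rfl fun s _ => ?_
        rw [← lintegral_const_mul' _ _ ENNReal.ofReal_ne_top]
        refine lintegral_congr fun x => ?_
        rw [hV, inner_smul_left, enorm_mul]
        simp only [conj_trivial]
        rw [Real.enorm_of_nonneg (hc j)]
    -- Summed over all signs, the inner products give at most `2 ^ n * ‖B V‖`, which cancels the
    -- normalization and leaves the factor `4`.
    _ ≤ ∑' j, ∫⁻ x, ENNReal.ofReal ε * (4 * ‖B (V (j, x))‖ₑ) := by
        refine ENNReal.tsum_le_tsum fun j => ?_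
        have hVj : Measurable fun x => V (j, x) := hVm.comp measurable_prodMk_left
        rw [← lintegral_finsetSum _ fun s _ => (hVj.inner measurable_const).enorm]
        refine lintegral_mono fun x => ?_
        simp only [hinner, Real.enorm_eq_ofReal_abs]
        rw [← ENNReal.ofReal_sum_of_nonneg fun s _ => abs_nonneg _, ← ofReal_norm,
          ← ENNReal.ofReal_ofNat 4, ← ENNReal.ofReal_mul (by norm_num),
          ← ENNReal.ofReal_mul hε.le]
        refine ENNReal.ofReal_le_ofReal ?_
        have h2 : (0 : ℝ) < 2 ^ n := by positivity
        simp only [abs_mul]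
        rw [← Finset.mul_sum, abs_of_pos hε, abs_of_pos (by positivity : (0 : ℝ) < 4 / 2 ^ n)]
        calc _ ≤ ε * (4 / 2 ^ n) * (2 ^ n * ‖B (V (j, x))‖) := by
              gcongr
              exact sum_abs_inner_signVector_le _
          _ = _ := by field_simp
    _ = ENNReal.ofReal ε * (4 * ∫⁻ p, ‖B (V p)‖ₑ ∂(Measure.count.prod volume)) := by
        have hBm : Measurable fun p => ‖B (V p)‖ₑ := (B.continuous.measurable.comp hVm).enorm
        rw [← lintegral_const_mul _ hBm, ← lintegral_const_mul _ (hBm.const_mul _),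
          lintegral_count_prod _ ((hBm.const_mul _).const_mul _)]

end Layers

/-! ### Unimodal densities and the theorem. -/

section Main

variable {n : ℕ}

local notation "E" => EuclideanSpace ℝ (Fin n)

/-- Otherwise `q` would be constant along `u`, which a nonzero compactly supported function cannot
be. This supplies nondegeneracy of the field from a single layer. -/
theorem eq_zero_of_inner_gradient_eq_zero {q : E → ℝ} {C : NNReal} (hq : LipschitzWith C q)
    (hc : HasCompactSupport q) {x₀ : E} (hx₀ : q x₀ ≠ 0) {u : E}
    (hu : ∀ᵐ x, (inner ℝ (gradient q x) u : ℝ) = 0) : u = 0 := by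
  by_contra hu0
  have htrans : ∀ t : ℝ, q (x₀ + t • u) = q x₀ := by
    intro t
    have h0 : ∫⁻ x, ‖q (x + t • u) - q x‖ₑ = 0 := by
      refine le_antisymm ((lintegral_increment_le q hq hc (t • u)).trans (le_of_eq ?_)) zero_le
      rw [lintegral_eq_zero_iff']
      · filter_upwards [hu] with x hx
        rw [inner_smul_right, hx, mul_zero, enorm_zero, Pi.zero_apply]
      · exact (((measurable_gradient q).inner measurable_const).enorm).aemeasurable
    have hcont : Continuous fun x => q (x + t • u) := hq.continuous.comp (by fun_prop)
    have hm : Measurable fun x => ‖q (x + t • u) - q x‖ₑ :=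
      (hcont.measurable.sub hq.continuous.measurable).enorm
    rw [lintegral_eq_zero_iff hm] at h0
    have h1 : (fun x => q (x + t • u)) =ᵐ[volume] q := by
      filter_upwards [h0] with x hx
      exact sub_eq_zero.1 (enorm_eq_zero.1 hx)
    exact congrFun ((hcont.ae_eq_iff_eq volume hq.continuous).1 h1) x₀
  obtain ⟨R, hR⟩ := hc.isBounded.subset_closedBall 0
  have hup : 0 < ‖u‖ := norm_pos_iff.2 hu0
  set t := (|R| + ‖x₀‖ + 1) / ‖u‖ with ht
  have hmem : x₀ + t • u ∈ tsupport q := subset_tsupport q (by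
    rw [Function.mem_support, htrans]; exact hx₀)
  have h1 : ‖x₀ + t • u‖ ≤ R := mem_closedBall_zero_iff.1 (hR hmem)
  have h2 : ‖t • u‖ = |R| + ‖x₀‖ + 1 := by
    rw [norm_smul, Real.norm_of_nonneg (by positivity), ht, div_mul_cancel₀ _ hup.ne']
  have h3 : ‖t • u‖ ≤ ‖x₀ + t • u‖ + ‖x₀‖ := by
    simpa using norm_sub_le (x₀ + t • u) x₀
  linarith [le_abs_self R]

theorem integrable_of_lintegral_enorm_map {Ω : Type*} [MeasurableSpace Ω] {m : Measure Ω}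
    {V : Ω → E} (hV : Measurable V) {A : E →L[ℝ] E} (hA : A.det ≠ 0)
    (h : ∫⁻ ω, ‖A (V ω)‖ₑ ∂m ≠ ∞) : Integrable V m := by
  have hi : Integrable (fun ω => A (V ω)) m :=
    ⟨(A.continuous.measurable.comp hV).aestronglyMeasurable, h.lt_top⟩
  have h2 := (A.toContinuousLinearEquivOfDetNeZero hA).symm.toContinuousLinearMap.integrable_comp hi
  refine h2.congr (Eventually.of_forall fun ω => ?_)
  exact (A.toContinuousLinearEquivOfDetNeZero hA).symm_apply_apply (V ω)

theorem setLIntegral_count_prod (F : ℕ × E → ℝ≥0∞) (hF : Measurable F) (S : Set ℕ) :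
    ∫⁻ p in Prod.fst ⁻¹' S, F p ∂(Measure.count.prod volume) =
      ∑' j, S.indicator (fun j => ∫⁻ x, F (j, x)) j := by
  have hS : MeasurableSet (Prod.fst ⁻¹' S : Set (ℕ × E)) := measurable_fst (MeasurableSet.of_discrete)
  rw [← lintegral_indicator hS, lintegral_count_prod _ (hF.indicator hS)]
  refine tsum_congr fun j => ?_
  by_cases hj : j ∈ S
  · rw [indicator_of_mem hj]
    exact lintegral_congr fun x => indicator_of_mem (show (j, x) ∈ Prod.fst ⁻¹' S from hj) _
  · rw [indicator_of_notMem hj]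
    simp [indicator_of_notMem, hj]

/-- The level sets `{f ≥ M / 2 ^ (j + 1)}` of a density bounded by `M` have total weighted volume
at most `2`, and the weighted sum of their indicators majorizes the density. -/
theorem tsum_volume_level_le {f : E → ℝ} (hf0 : ∀ x, 0 ≤ f x) (hfm : AEMeasurable f volume) {M : ℝ}
    (hM : 0 < M) (hfM : ∀ᵐ x, f x ≤ M) (hf1 : ∫⁻ x, ENNReal.ofReal (f x) = 1) :
    ∑' j : ℕ, ENNReal.ofReal (M / 2 ^ (j + 1)) * volume {x | M / 2 ^ (j + 1) ≤ f x} ≤ 2 := by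
  have hnull : ∀ j : ℕ, NullMeasurableSet {x | M / 2 ^ (j + 1) ≤ f x} volume := fun j =>
    nullMeasurableSet_le aemeasurable_const hfm
  calc ∑' j : ℕ, ENNReal.ofReal (M / 2 ^ (j + 1)) * volume {x | M / 2 ^ (j + 1) ≤ f x}
      = ∑' j : ℕ, ∫⁻ x, {x | M / 2 ^ (j + 1) ≤ f x}.indicator
          (fun _ => ENNReal.ofReal (M / 2 ^ (j + 1))) x := by
        refine tsum_congr fun j => ?_
        rw [lintegral_indicator_const₀ (hnull j)]
    _ = ∫⁻ x, ∑' j : ℕ, {x | M / 2 ^ (j + 1) ≤ f x}.indicator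
          (fun _ => ENNReal.ofReal (M / 2 ^ (j + 1))) x :=
        (lintegral_tsum fun j => aemeasurable_const.indicator₀ (hnull j)).symm
    _ ≤ ∫⁻ x, 2 * ENNReal.ofReal (f x) := by
        refine lintegral_mono_ae ?_
        filter_upwards [hfM] with x hx
        simpa only [indicator_apply, mem_ofPred_eq] using (dyadic_layers hM (hf0 x) hx).2
    _ = 2 := by rw [lintegral_const_mul' _ _ (by norm_num), hf1, mul_one]

/-- `nⁿ ≤ 3ⁿ n!` by the exponential series and `n ≤ 2ⁿ`; then `3 * 2 * 6 * 36 = 1296`. -/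
theorem le_of_factorial_mul_pow_le (hn : 0 < n) {τ M : ℝ} (hτ : 0 ≤ τ) (hM : 0 < M)
    (h : n.factorial * τ ^ n ≤ n ^ n * (n * (6 * n) ^ n * 36 ^ n * M)) :
    τ ≤ 1296 * n * M ^ (1 / (n : ℝ)) := by
  have hn' : (0 : ℝ) < n := by exact_mod_cast hn
  have hfac : (0 : ℝ) < n.factorial := by exact_mod_cast n.factorial_pos
  have h1 : (n : ℝ) ^ n ≤ 3 ^ n * n.factorial := by
    have h2 := Real.pow_div_factorial_le_exp (n : ℝ) hn'.le n
    rw [div_le_iff₀ hfac] at h2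
    refine h2.trans ?_
    gcongr
    rw [← Real.exp_one_pow]
    gcongr
    exact (Real.exp_one_lt_d9.trans (by norm_num)).le
  have h2 : (n : ℝ) ≤ 2 ^ n := by exact_mod_cast Nat.lt_two_pow_self.le
  have h3 : n.factorial * τ ^ n ≤ n.factorial * ((1296 * n) ^ n * M) := by
    refine h.trans ?_
    calc (n : ℝ) ^ n * (n * (6 * n) ^ n * 36 ^ n * M)
        ≤ (3 ^ n * n.factorial) * (2 ^ n * (6 * n) ^ n * 36 ^ n * M) := by gcongr
      _ = n.factorial * ((3 * 2 * (6 * n) * 36) ^ n * M) := by simp only [mul_pow]; ring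
      _ = _ := by congr 3; ring
  have h4 : τ ^ n ≤ (1296 * n * M ^ (1 / (n : ℝ))) ^ n := by
    rw [mul_pow, ← Real.rpow_natCast (M ^ _), ← Real.rpow_mul hM.le, one_div_mul_cancel hn'.ne',
      Real.rpow_one]
    exact le_of_mul_le_mul_left h3 hfac
  exact (pow_le_pow_iff_left₀ hτ (by positivity) hn.ne').1 h4

/-- A bounded unimodal density has a volume-preserving linear image of small maximal perimeter. -/
theorem exists_linear_maxPerimeter_le (hn : 0 < n) {f : E → ℝ} (hf0 : ∀ x, 0 ≤ f x)
    (hfm : AEMeasurable f volume) (hfu : IsUnimodal f) {M : ℝ} (hM : 0 < M)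
    (hfM : ∀ᵐ x, f x ≤ M) (hf1 : ∫⁻ x, ENNReal.ofReal (f x) = 1) :
    ∃ T : E ≃L[ℝ] E, |(T : E →L[ℝ] E).det| = 1 ∧
      maxPerimeter (((volume : Measure E).withDensity fun x => ENNReal.ofReal (f x)).map T) ≤
        ENNReal.ofReal (5184 * n * M ^ (1 / (n : ℝ))) := by
  have hn' : (0 : ℝ) < n := by exact_mod_cast hn
  set c : ℕ → ℝ := fun j => M / 2 ^ (j + 1) with hc
  have hc0 : ∀ j, 0 < c j := fun j => by positivity
  set K : ℕ → Set E := fun j => {x | c j ≤ f x} with hK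
  have hKc : ∀ j, Convex ℝ (K j) := fun j => hfu _ (hc0 j)
  have hKmono : Monotone K := by
    intro i j hij x (hx : c i ≤ f x)
    refine le_trans ?_ hx
    simp only [hc]
    gcongr
    norm_num
  have hvol : ∑' j, ENNReal.ofReal (c j) * volume (K j) ≤ 2 :=
    tsum_volume_level_le hf0 hfm hM hfM hf1
  have hKi : ∀ j, volume (K j) ≠ ∞ := by
    intro j hj
    have h1 := (ENNReal.le_tsum (f := fun j => ENNReal.ofReal (c j) * volume (K j)) j).trans hvol
    simp only [hj] at h1
    rw [ENNReal.mul_top (ENNReal.ofReal_pos.2 (hc0 j)).ne'] at h1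
    exact absurd h1 (by simp)
  -- Null level sets, which need not have interior, receive the zero function; they affect the
  -- majorization of `f` only on a null set.
  have hex : ∀ j, ∃ (q : E → ℝ) (A : E →L[ℝ] E), (∃ C, LipschitzWith C q) ∧ HasCompactSupport q ∧
      (volume (K j) = 0 → q = 0) ∧ (volume (K j) ≠ 0 → ∀ x ∈ K j, 1 ≤ q x) ∧
      (volume (K j) ≠ 0 → ∀ (A' : E →L[ℝ] E) (c : E), (∀ u, ‖u‖ ≤ 1 → c + A' u ∈ K j) →
        ∫⁻ x, ‖ContinuousLinearMap.adjoint A' (gradient q x)‖ₑ ≤ 3 * n * volume (K j)) ∧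
      (volume (K j) ≠ 0 → ∃ c : E, ∀ u, ‖u‖ ≤ 1 → c + A u ∈ K j) ∧
      (volume (K j) ≠ 0 → A.det ≠ 0 ∧ volume (K j) ≤ ENNReal.ofReal (36 ^ n * |A.det|)) := by
    intro j
    by_cases h0 : volume (K j) = 0
    · exact ⟨0, 0, ⟨0, LipschitzWith.const 0⟩, HasCompactSupport.zero, fun _ => rfl,
        fun h => absurd h0 h, fun h => absurd h0 h, fun h => absurd h0 h, fun h => absurd h0 h⟩
    · obtain ⟨q, hq1, hq2, -, hq4, hq5⟩ := exists_lipschitz_majorant hn (hKc j) h0 (hKi j)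
      obtain ⟨A, b, hA1, hA2⟩ := exists_ellipsoid hn (hKc j) h0 (hKi j)
      refine ⟨q, A, hq1, hq2, fun h => absurd h h0, fun _ => hq4, fun _ => hq5, fun _ => ⟨b, hA1⟩,
        fun _ => ⟨fun hd => h0 ?_, hA2⟩⟩
      rw [hd, abs_zero, mul_zero, ENNReal.ofReal_zero] at hA2
      exact le_antisymm hA2 zero_le
  choose q A hqL hqc hq0 hq1 hqA hAK hAd using hex
  set G : Set ℕ := {j | volume (K j) ≠ 0} with hG
  have hfq : ∀ᵐ x, ENNReal.ofReal (f x) ≤ ∑' j, ENNReal.ofReal (c j) * ENNReal.ofReal (q j x) := by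
    have hae : ∀ᵐ x, ∀ j, volume (K j) = 0 → x ∉ K j := by
      rw [ae_all_iff]
      intro j
      by_cases h0 : volume (K j) = 0
      · filter_upwards [measure_eq_zero_iff_ae_notMem.1 h0] with x hx _ using hx
      · exact Eventually.of_forall fun x h => absurd h h0
    filter_upwards [hfM, hae] with x hx hxK
    refine (dyadic_layers hM (hf0 x) hx).1.trans (ENNReal.tsum_le_tsum fun j => ?_)
    split_ifs with h
    · have h1 : 1 ≤ q j x := hq1 j (fun h0 => hxK j h0 h) x h
      exact le_mul_of_one_le_right zero_le (ENNReal.one_le_ofReal.2 h1)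
    · exact zero_le
  set V : ℕ × E → E := fun p => c p.1 • gradient (q p.1) p.2 with hV
  have hVm : Measurable V := measurable_from_prod_countable_right fun j =>
    (measurable_gradient (q j)).const_smul (c j)
  set m : Measure (ℕ × E) := Measure.count.prod volume with hm
  have hVG : ∀ p, V p ≠ 0 → p.1 ∈ G := by
    intro p hp h0
    refine hp ?_
    simp only [hV]
    rw [hq0 _ h0]
    simp [gradient]
  have hAm : ∀ j, Measurable fun p => ‖ContinuousLinearMap.adjoint (A j) (V p)‖ₑ := fun j =>
    ((ContinuousLinearMap.adjoint (A j)).continuous.measurable.comp hVm).enorm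
  -- Level sets are nested, so the ellipsoid of layer `j` also lies in every later level set.
  have hlayer : ∀ j ∈ G, ∀ k, j ≤ k → ∫⁻ x, ‖ContinuousLinearMap.adjoint (A j) (V (k, x))‖ₑ ≤
      3 * n * (ENNReal.ofReal (c k) * volume (K k)) := by
    intro j hj k hjk
    have hk : volume (K k) ≠ 0 := fun h => hj (measure_mono_null (hKmono hjk) h)
    obtain ⟨b, hb⟩ := hAK j hj
    have h1 := hqA k hk (A j) b fun u hu => hKmono hjk (hb u hu)
    calc _ = ∫⁻ x, ENNReal.ofReal (c k) *
          ‖ContinuousLinearMap.adjoint (A j) (gradient (q k) x)‖ₑ := by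
          refine lintegral_congr fun x => ?_
          simp only [hV]
          rw [map_smul, enorm_smul, Real.enorm_of_nonneg (hc0 k).le]
      _ = ENNReal.ofReal (c k) * ∫⁻ x, ‖ContinuousLinearMap.adjoint (A j) (gradient (q k) x)‖ₑ :=
          lintegral_const_mul' _ _ ENNReal.ofReal_ne_top
      _ ≤ ENNReal.ofReal (c k) * (3 * n * volume (K k)) := by gcongr
      _ = _ := by ring
  have hsum : ∑' k, 3 * n * (ENNReal.ofReal (c k) * volume (K k)) ≤ 6 * (n : ℝ≥0∞) := by
    rw [ENNReal.tsum_mul_left]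
    calc _ ≤ 3 * (n : ℝ≥0∞) * 2 := by gcongr
      _ = _ := by ring
  have ha : ∀ j ∈ G, ∫⁻ p in {p | j ≤ p.1}, ‖ContinuousLinearMap.adjoint (A j) (V p)‖ₑ ∂m ≤
      6 * (n : ℝ≥0∞) := by
    intro j hj
    refine le_trans (le_of_eq (setLIntegral_count_prod _ (hAm j) {k | j ≤ k})) ?_
    refine le_trans (ENNReal.tsum_le_tsum fun k => ?_) hsum
    rw [indicator_apply]
    split_ifs with hk
    · exact hlayer j hj k hk
    · exact zero_le
  -- In its own layer the ellipsoid fills the level set up to `36 ^ n`, which turns the volume into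
  -- `|det A_j|`.
  have hb : ∀ j ∈ G, ∫⁻ p in {p | p.1 = j}, ‖ContinuousLinearMap.adjoint (A j) (V p)‖ₑ ∂m ≤
      ENNReal.ofReal |(A j).det| * (3 * n * 36 ^ n * ENNReal.ofReal (c j)) := by
    intro j hj
    refine le_trans (le_of_eq (setLIntegral_count_prod _ (hAm j) {k | k = j})) ?_
    rw [tsum_eq_single j fun k hk => indicator_of_notMem (s := {k | k = j}) hk _,
      indicator_of_mem (s := {k | k = j}) rfl]
    refine (hlayer j hj j le_rfl).trans ?_
    have h1 := (hAd j hj).2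
    rw [ENNReal.ofReal_mul (by positivity), ENNReal.ofReal_pow (by norm_num),
      ENNReal.ofReal_ofNat] at h1
    calc _ ≤ 3 * (n : ℝ≥0∞) * (ENNReal.ofReal (c j) * (36 ^ n * ENNReal.ofReal |(A j).det|)) := by
          gcongr
      _ = _ := by ring
  have hGne : G.Nonempty := by
    by_contra hne
    rw [not_nonempty_iff_eq_empty] at hne
    have h0 : ∀ j, q j = 0 := fun j => hq0 j (by
      by_contra h; exact (hne ▸ (h : j ∈ G) : j ∈ (∅ : Set ℕ)))
    have h1 := lintegral_mono_ae hfq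
    rw [hf1] at h1
    simp [h0] at h1
  classical
  -- The ellipsoid of the first non-null layer controls all layers at once.
  have hVi : Integrable V m := by
    set j := Nat.find hGne with hj
    have hjG : j ∈ G := Nat.find_spec hGne
    refine integrable_of_lintegral_enorm_map hVm (A := ContinuousLinearMap.adjoint (A j)) ?_ ?_
    · rw [det_adjoint_eq]; exact (hAd j hjG).1
    · have h1 : ∫⁻ p, ‖ContinuousLinearMap.adjoint (A j) (V p)‖ₑ ∂m =
          ∫⁻ p in {p | j ≤ p.1}, ‖ContinuousLinearMap.adjoint (A j) (V p)‖ₑ ∂m := by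
        symm
        refine setLIntegral_eq_of_support_subset fun p hp => ?_
        refine Nat.find_min' hGne (hVG p fun h => hp ?_)
        simp [h]
      rw [h1]
      exact ((ha j hjG).trans_lt (by finiteness)).ne
  have hnd : ∀ u : E, ∫ p, |inner ℝ (V p) u| ∂m = 0 → u = 0 := by
    intro u hu
    obtain ⟨j, hj⟩ := hGne
    have h1 : ∀ᵐ p ∂m, (inner ℝ (V p) u : ℝ) = 0 := by
      have := (integral_eq_zero_iff_of_nonneg (fun p => abs_nonneg _)
        (hVi.inner_const u).abs).1 hu
      filter_upwards [this] with p hp using abs_eq_zero.1 hp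
    have h2 := Measure.ae_ae_of_ae_prod h1
    rw [Measure.ae_count_iff] at h2
    obtain ⟨C, hC⟩ := hqL j
    obtain ⟨x₀, hx₀⟩ := nonempty_of_measure_ne_zero hj
    refine eq_zero_of_inner_gradient_eq_zero hC (hqc j) (x₀ := x₀)
      (zero_lt_one.trans_le (hq1 j hj x₀ hx₀)).ne' ?_
    filter_upwards [h2 j] with x hx
    simp only [hV, inner_smul_left, conj_trivial] at hx
    exact (mul_eq_zero.1 hx).resolve_left (hc0 j).ne'
  have hD : ∫ ω : Fin n → ℕ × E, |vecDet (fun i => V (ω i))| ∂(Measure.pi fun _ => m) ≤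
      n * (6 * n) ^ n * 36 ^ n * M := by
    have h1 := lintegral_vecDet_le m hVm measurable_fst G hVG A (fun j hj => (hAd j hj).1) _ _ ha hb
      hn
    rw [integral_eq_lintegral_of_nonneg_ae (Eventually.of_forall fun _ => abs_nonneg _)
      (integrable_abs_vecDet hVi).aestronglyMeasurable]
    refine ENNReal.toReal_le_of_le_ofReal (by positivity) ?_
    simp only [Real.enorm_eq_ofReal_abs] at h1
    refine h1.trans ?_
    rw [ENNReal.tsum_mul_left]
    calc _ ≤ (n : ℝ≥0∞) * ((6 * n) ^ (n - 1) * (3 * n * 36 ^ n * (2 * ENNReal.ofReal M))) := by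
          gcongr
          exact tsum_dyadic hM
      _ = n * ((6 * n) ^ (n - 1) * (6 * n)) * 36 ^ n * ENNReal.ofReal M := by ring
      _ = n * (6 * n) ^ n * 36 ^ n * ENNReal.ofReal M := by rw [pow_sub_one_mul hn.ne']
      _ = _ := by
          rw [ENNReal.ofReal_mul (by positivity), ENNReal.ofReal_mul (by positivity),
            ENNReal.ofReal_mul (by positivity), ENNReal.ofReal_pow (by positivity),
            ENNReal.ofReal_pow (by positivity), ENNReal.ofReal_mul (by positivity)]
          simp
  -- The required map is `T = (B*)⁻¹`, so that the adjoint of its inverse is `B`. The final constant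
  -- is `4 * 1296 = 5184`.
  obtain ⟨B, hB1, hB2⟩ := exists_unimodular_position hn hVi hnd
  have hτ := le_of_factorial_mul_pow_le hn (integral_nonneg fun p => norm_nonneg (B (V p))) hM
    (hB2.trans (by gcongr))
  have hBa : (ContinuousLinearMap.adjoint B).det ≠ 0 := by
    rw [det_adjoint_eq]
    intro h; simp [h] at hB1
  set S := (ContinuousLinearMap.adjoint B).toContinuousLinearEquivOfDetNeZero hBa with hS
  have hSc : (S : E →L[ℝ] E) = ContinuousLinearMap.adjoint B := by ext x; rfl
  refine ⟨S.symm, ?_, ?_⟩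
  · have h1 : (S : E →L[ℝ] E).det * (S.symm : E →L[ℝ] E).det = 1 := by
      have := LinearEquiv.det_mul_det_symm S.toLinearEquiv
      exact this
    rw [hSc, det_adjoint_eq] at h1
    have h2 := congrArg abs h1
    rwa [abs_mul, hB1, one_mul, abs_one] at h2
  · refine (maxPerimeter_map_le _ c (fun j => (hc0 j).le) q hqL hqc hfq V hVm (fun _ => rfl)
      S.symm).trans ?_
    rw [ContinuousLinearEquiv.symm_symm, hSc, ContinuousLinearMap.adjoint_adjoint,
      ← ofReal_integral_norm_eq_lintegral_enorm (B.integrable_comp hVi), ← ENNReal.ofReal_ofNat 4,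
      ← ENNReal.ofReal_mul (by norm_num)]
    refine ENNReal.ofReal_le_ofReal ?_
    linarith

theorem exists_volumePreserving_Gam_le {Ω : Type*} [MeasurableSpace Ω] (P : Measure Ω)
    [IsProbabilityMeasure P] (X : Ω → E) (f : E → ℝ) (hX : HasDensity P X f) (hf : IsUnimodal f) :
    ∃ T : E →ₗ[ℝ] E, MeasurePreserving T volume volume ∧
      Gam P (fun ω => T (X ω)) ≤
        ENNReal.ofReal 5184 * (n : ℝ≥0∞) * eLpNorm f ∞ volume ^ (1 / (n : ℝ)) := by
  have hid : MeasurePreserving (LinearMap.id : E →ₗ[ℝ] E) volume volume := MeasurePreserving.id _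
  -- In dimension zero nothing is added to a nonempty `Q`, so all perimeters vanish. For `n > 0` and
  -- an essentially unbounded density the bound is `∞`, and the identity serves.
  rcases Nat.eq_zero_or_pos n with rfl | hn
  · refine ⟨LinearMap.id, hid, ?_⟩
    refine (iSup₂_le fun Q _ => perimeter_le_of_forall (c := 0) fun ε _ => ?_).trans zero_le
    rw [mul_zero]
    refine le_of_eq (measure_mono_null (t := ∅) ?_ measure_empty)
    rintro x ⟨⟨y, hy, -⟩, hx⟩
    exact hx (Subsingleton.elim y x ▸ hy)
  have hf1 : ∫⁻ x, ENNReal.ofReal (f x) = 1 := by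
    have h1 : P.map X univ = 1 := by
      rw [Measure.map_apply_of_aemeasurable hX.hasLaw.aemeasurable MeasurableSet.univ]
      simp
    rwa [hX.hasLaw.map_eq, withDensity_apply _ MeasurableSet.univ, setLIntegral_univ] at h1
  by_cases htop : eLpNorm f ∞ volume = ∞
  · refine ⟨LinearMap.id, hid, le_top.trans_eq ?_⟩
    have hn' : (0 : ℝ) < n := by exact_mod_cast hn
    rw [htop, ENNReal.top_rpow_of_pos (by positivity), ENNReal.mul_top]
    have : n ≠ 0 := hn.ne'
    simp [this]
  have hbd : ∀ᵐ x, f x ≤ (eLpNorm f ∞ volume).toReal := by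
    rw [eLpNorm_exponent_top] at htop ⊢
    filter_upwards [enorm_ae_le_eLpNormEssSup f volume] with x hx
    have := ENNReal.toReal_mono htop hx
    rw [toReal_enorm] at this
    exact (le_abs_self _).trans this
  have hM : 0 < (eLpNorm f ∞ volume).toReal := by
    rw [ENNReal.toReal_pos_iff]
    refine ⟨pos_iff_ne_zero.2 fun h0 => ?_, Ne.lt_top htop⟩
    rw [h0] at hbd
    have h1 : ∫⁻ x, ENNReal.ofReal (f x) = 0 := by
      rw [← lintegral_zero (μ := (volume : Measure E))]
      refine lintegral_congr_ae ?_
      filter_upwards [hbd] with x hx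
      exact ENNReal.ofReal_of_nonpos hx
    exact one_ne_zero (hf1.symm.trans h1)
  obtain ⟨T, hT1, hT2⟩ := exists_linear_maxPerimeter_le hn hX.nonneg hX.aemeasurable hf hM hbd hf1
  refine ⟨T.toLinearEquiv, measurePreserving_of_abs_det_eq_one hT1, ?_⟩
  have hmap : P.map (fun ω => (T.toLinearEquiv : E →ₗ[ℝ] E) (X ω)) =
      ((volume : Measure E).withDensity fun x => ENNReal.ofReal (f x)).map T := by
    rw [← hX.hasLaw.map_eq, AEMeasurable.map_map_of_aemeasurable
      T.continuous.measurable.aemeasurable hX.hasLaw.aemeasurable]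
    rfl
  unfold Gam
  rw [hmap]
  refine hT2.trans (le_of_eq ?_)
  rw [ENNReal.ofReal_mul (by positivity), ENNReal.ofReal_mul (by positivity),
    ← ENNReal.ofReal_rpow_of_pos hM, ENNReal.ofReal_toReal htop, ENNReal.ofReal_natCast]

end Main

theorem theorem2 :
    (∃ C : ℝ, 0 < C ∧
      ∀ (n : ℕ) (Ω : Type*) [MeasurableSpace Ω] (P : Measure Ω) [IsProbabilityMeasure P]
        (X : Ω → EuclideanSpace ℝ (Fin n)) (f : EuclideanSpace ℝ (Fin n) → ℝ),
        HasDensity P X f → IsUnimodal f →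
        ∃ T : EuclideanSpace ℝ (Fin n) →ₗ[ℝ] EuclideanSpace ℝ (Fin n),
          MeasurePreserving T volume volume ∧
          Gam P (fun ω => T (X ω)) ≤
            ENNReal.ofReal C * (n : ℝ≥0∞) * eLpNorm f ∞ volume ^ (1 / (n : ℝ))) ∧
    (∀ (n : ℕ) (Ω : Type*) [MeasurableSpace Ω] (P : Measure Ω) [IsProbabilityMeasure P]
        (X : Ω → EuclideanSpace ℝ (Fin n)),
        HasDensity P X (uniformDensity (cube n)) →
        Gam P X =
            2 * (n : ℝ≥0∞) * eLpNorm (uniformDensity (cube n)) ∞ volume ^ (1 / (n : ℝ)) ∧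
        ∀ T : EuclideanSpace ℝ (Fin n) →ₗ[ℝ] EuclideanSpace ℝ (Fin n),
          MeasurePreserving T volume volume →
          2 * (n : ℝ≥0∞) * eLpNorm (uniformDensity (cube n)) ∞ volume ^ (1 / (n : ℝ)) ≤
            Gam P (fun ω => T (X ω))) := by
  refine ⟨⟨5184, by norm_num, fun n Ω _ P _ X f => exists_volumePreserving_Gam_le P X f⟩,
    fun n Ω _ P _ X hX => ?_⟩
  rw [two_mul_card_mul_norm_cube]
  exact uniform_cube_perimeter P X hX
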